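/- Let $G$ be a Fuchsian group, i.e. a discrete subgroup of $SL(2,\mathbb{R})$, acting on the hyperbolic plane $\mathbb{H}^2$ by Möbius transformations, and suppose that the quotient $G\backslash\mathbb{H}^2$ has finite hyperbolic area but is not compact. Let $G$ act on the circle $S^1=\partial\mathbb{D}$ at infinity of the unit disc model $\mathbb{D}$ of $\mathbb{H}^2$ (obtained from the upper half-plane by the Cayley transform $z\mapsto (z-i)/(z+i)$), and for $g\in G$ and $p\in S^1$ let $|g'(p)|$ denote the absolute value of the derivative of $g:S^1\to S^1$ at $p$ with respect to the angle. Let $S$ be any finite generating set of $G$, and for $R\in\mathbb{N}$ let $B(R)\subset G$ be the ball of radius $R$ about the identity in the word metric of $S$. Then for Lebesgue-almost every $p\in S^1$ the Lyapunov expansion exponent $$\lambda_{exp}(p):=\limsup_{R\to\infty}\ \max_{g\in B(R)}\ \frac1R\log|g'(p)|$$ is equal to $0$. -/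

import Mathlib

open scoped MatrixGroups UpperHalfPlane ComplexConjugate

noncomputable section

namespace Fuchsian

/-! ### Isometries in the disc model

The Cayley transform `z ↦ (z - i) / (z + i)` identifies the upper half-plane with the unit disc and
turns `g = !![a, b; c, d]` into the Möbius map `w ↦ (α w + β) / (conj β w + conj α)`, which extends
to the boundary circle. -/

/-- The coefficient `α = ((a + d) + i (b - c)) / 2`. -/
def discA (g : SL(2, ℝ)) : ℂ := ⟨(g 0 0 + g 1 1) / 2, (g 0 1 - g 1 0) / 2⟩

/-- The coefficient `β = ((a - d) - i (b + c)) / 2`. -/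
def discB (g : SL(2, ℝ)) : ℂ := ⟨(g 0 0 - g 1 1) / 2, -(g 0 1 + g 1 0) / 2⟩

/-- The Möbius map of the disc model given by `g`, as a formula on `ℂ`. -/
def discMap (g : SL(2, ℝ)) (w : ℂ) : ℂ :=
  (discA g * w + discB g) / (conj (discB g) * w + conj (discA g))

/-- The Cayley transform from the upper half-plane to the unit disc. -/
def cayley (z : ℍ) : ℂ := ((z : ℂ) - Complex.I) / ((z : ℂ) + Complex.I)

lemma normSq_discA_sub (g : SL(2, ℝ)) :
    Complex.normSq (discA g) - Complex.normSq (discB g) = 1 := by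
  have h := g.det_coe
  rw [Matrix.det_fin_two] at h
  simp only [discA, discB, Complex.normSq_mk]
  linarith

lemma discMap_denom_ne_zero (g : SL(2, ℝ)) {w : ℂ} (hw : ‖w‖ ≤ 1) :
    conj (discB g) * w + conj (discA g) ≠ 0 := by
  intro h
  have h1 : ‖discA g‖ = ‖discB g‖ * ‖w‖ := by
    have := congrArg norm (eq_neg_of_add_eq_zero_right h)
    simpa using this
  have h2 := normSq_discA_sub g
  rw [Complex.normSq_eq_norm_sq, Complex.normSq_eq_norm_sq] at h2
  have h3 : ‖discA g‖ ≤ ‖discB g‖ := by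
    rw [h1]; exact mul_le_of_le_one_right (norm_nonneg _) hw
  nlinarith [norm_nonneg (discA g), norm_nonneg (discB g)]

/-- `discMap g` is the action of `g` on the upper half-plane, read through the Cayley transform. -/
theorem cayley_smul (g : SL(2, ℝ)) (z : ℍ) : cayley (g • z) = discMap g (cayley z) := by
  have hz : (z : ℂ) + Complex.I ≠ 0 := by
    intro h
    have := congrArg Complex.im h
    simp at this
    linarith [z.im_pos]
  have hd : (g 1 0 : ℂ) * z + g 1 1 ≠ 0 := by
    have := UpperHalfPlane.denom_ne_zero (g : GL (Fin 2) ℝ) z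
    simpa [UpperHalfPlane.denom] using this
  have hz' : ((g • z : ℍ) : ℂ) + Complex.I ≠ 0 := by
    intro h
    have := congrArg Complex.im h
    simp only [Complex.add_im, UpperHalfPlane.coe_im, Complex.I_im, Complex.zero_im] at this
    linarith [(g • z).im_pos]
  have hA : discA g = ((g 0 0 + g 1 1) + Complex.I * (g 0 1 - g 1 0)) / 2 := by
    apply Complex.ext <;> simp [discA]
  have hB : discB g = ((g 0 0 - g 1 1) - Complex.I * (g 0 1 + g 1 0)) / 2 := by
    apply Complex.ext <;> simp [discB]
  have hnorm : ‖cayley z‖ ≤ 1 := by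
    rw [cayley, norm_div]
    refine div_le_one_of_le₀ ?_ (norm_nonneg _)
    rw [← sq_le_sq₀ (norm_nonneg _) (norm_nonneg _), ← Complex.normSq_eq_norm_sq,
      ← Complex.normSq_eq_norm_sq, Complex.normSq_apply, Complex.normSq_apply]
    simp
    nlinarith [z.im_pos]
  have hden := discMap_denom_ne_zero g hnorm
  have hI : Complex.I ^ 2 = -1 := Complex.I_sq
  rw [discMap, eq_div_iff hden]
  rw [cayley, div_mul_eq_mul_div, div_eq_iff hz', hA, hB, cayley]
  rw [UpperHalfPlane.coe_specialLinearGroup_apply]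
  simp only [Algebra.algebraMap_self, RingHom.id_apply, map_div₀, map_add, map_sub, map_mul,
    Complex.conj_I, Complex.conj_ofReal, map_ofNat]
  generalize (z : ℂ) = x at *
  generalize ((g 0 0 : ℝ) : ℂ) = a at *
  generalize ((g 0 1 : ℝ) : ℂ) = b at *
  generalize ((g 1 0 : ℝ) : ℂ) = c at *
  generalize ((g 1 1 : ℝ) : ℂ) = d at *
  obtain ⟨y, hy⟩ : ∃ y, y = (a * x + b) / (c * x + d) := ⟨_, rfl⟩
  rw [← hy]
  rw [eq_div_iff hd] at hy
  field_simp
  ring_nf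
  simp only [hI, show Complex.I ^ 3 = -Complex.I from Complex.I_pow_three]
  linear_combination 4 * Complex.I * hy

lemma norm_discMap (g : SL(2, ℝ)) (w : Circle) : ‖discMap g w‖ = 1 := by
  have hw : conj (w : ℂ) * w = 1 := by
    rw [← Complex.normSq_eq_conj_mul_self, Circle.normSq_coe, Complex.ofReal_one]
  have h : conj (discB g) * (w : ℂ) + conj (discA g) = conj (discA g * w + discB g) * w := by
    simp only [map_add, map_mul]
    linear_combination -(conj (discA g)) * hw
  have h0 := discMap_denom_ne_zero g (w := w) (Circle.norm_coe w).le
  rw [discMap, norm_div, div_eq_one_iff_eq (norm_ne_zero_iff.2 h0), h, norm_mul, Circle.norm_coe,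
    mul_one, Complex.norm_conj]

/-- The action of `g` on the circle at infinity `S¹`, the boundary of the unit disc. -/
def boundaryMap (g : SL(2, ℝ)) (w : Circle) : Circle :=
  ⟨discMap g w, mem_sphere_zero_iff_norm.2 (norm_discMap g w)⟩

/-! ### Quotient of finite area -/

/-- The orbifold `G \ ℍ` has finite area: there is a fundamental domain of finite hyperbolic area
(`volume` on `ℍ` is `dx dy / y ^ 2`) for the group of transformations of `ℍ` induced by `G`.
The induced group is used because `-1` acts trivially and may belong to `G`. -/
def HasFiniteCoarea (G : Subgroup SL(2, ℝ)) : Prop :=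
  ∃ F : Set ℍ, MeasureTheory.IsFundamentalDomain (MulAction.toPermHom G ℍ).range F
    MeasureTheory.volume ∧ MeasureTheory.volume F < ⊤

/-! ### Lyapunov expansion exponent -/

/-- The ball of radius `R` about `1` for the word metric of `S`: all products of at most `R`
elements of `S ∪ S⁻¹`. -/
def wordBall {Γ : Type*} [Group Γ] (S : Set Γ) (R : ℕ) : Set Γ :=
  {g | ∃ l : List Γ, l.length ≤ R ∧ (∀ s ∈ l, s ∈ S ∨ s⁻¹ ∈ S) ∧ l.prod = g}

/-- `|f'(p)|` for a map `f` of the circle, with respect to the angle `t` in `p * exp (i t)`: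
if `f (p * exp (i t)) = exp (i h(t))`, this is `|h'(0)|`. -/
def absDeriv (f : Circle → Circle) (p : Circle) : ℝ :=
  ‖deriv (fun t : ℝ => (f (p * Circle.exp t) : ℂ)) 0‖

/-- The Lyapunov expansion exponent at `p` of the group `Γ` with generating set `S` acting on the
circle by `act`, with values in `[-∞, ∞]`. -/
def lyapunovExpansionExponent {Γ : Type*} [Group Γ] (act : Γ → Circle → Circle) (S : Set Γ)
    (p : Circle) : EReal :=
  Filter.limsup
    (fun R : ℕ => ⨆ g ∈ wordBall S R, ((1 / (R : ℝ) * Real.log (absDeriv (act g) p) : ℝ) : EReal))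
    Filter.atTop

end Fuchsian

end

/-! A matrix `h` is a frame whose geodesic `t ↦ (h * diagFlow t) • i` ends at the boundary point `h
• ∞`. The frame `rotation θ` ends at `exp (i θ)`, and there `|g'|` is the inverse squared length of
the first column of `g * rotation θ` (`absDeriv_boundaryMap`). Up to a constant depending on `h`,
`log |g'|` at `h • ∞` is at most `logModulus (g * h)`, the time at which the geodesic of `h` is
closest to `g⁻¹ • i` (`neg_log_colSq_le_logModulus`). So strong expansion by a short word means
travelling far along a geodesic with few generators.

Travelling through a cusp is expensive. If an orbit point lies at distance `d` from the geodesic,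
one generator moves its projection by `O(1 / cosh d)` (`abs_logModulus_mul_sub_le`), while on the
piece covered `cuspWeight`, the exponential of the distance to the orbit `G • i`, is `O(cosh d)`.
Hence the weight integrated along the geodesic is at most a constant times the word length
(`intervalIntegral_le_mul_length`).

Suppose the frames where expansion beats `ε` per letter have positive measure. By ergodicity they
have full measure (`haarSL_eq_zero_or_compl`), and the maximal ergodic theorem for the geodesic flow
on `G \ SL(2, ℝ)` bounds the integral of every truncation of the weight by one constant. But the
weight has infinite integral (`exists_lt_integral_min_cuspWeight`): by noncompactness there are
points at every distance `r` from the orbit, and a small ball there has mass at least of order `exp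
(-r)` in the quotient, because a discrete group has few small elements (`exists_encard_conj_le`).
Fubini passes from almost every frame to almost every angle (`ae_rotation_notMem`). -/

namespace Fuchsian

open MeasureTheory Set Filter Topology
open scoped Pointwise

/-! ### Elementary matrices and the Haar measure of `SL(2, ℝ)` -/

/-- The upper unipotent matrix with entry `x`. -/
def upperUnipotent (x : ℝ) : SL(2, ℝ) := ⟨!![1, x; 0, 1], by simp⟩

/-- The lower unipotent matrix with entry `x`. -/
def lowerUnipotent (x : ℝ) : SL(2, ℝ) := ⟨!![1, 0; x, 1], by simp⟩

/-- The diagonal matrix that acts as the geodesic flow for time `t`. -/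
noncomputable def diagFlow (t : ℝ) : SL(2, ℝ) :=
  ⟨!![Real.exp (t / 2), 0; 0, Real.exp (-(t / 2))], by simp [← Real.exp_add]⟩

lemma mul_entry (g h : SL(2, ℝ)) (i j : Fin 2) :
    (g * h) i j = g i 0 * h 0 j + g i 1 * h 1 j := by
  rw [Matrix.SpecialLinearGroup.coe_mul, Matrix.mul_apply, Fin.sum_univ_two]

@[simp] lemma upperUnipotent_coe (x : ℝ) :
    (upperUnipotent x : Matrix (Fin 2) (Fin 2) ℝ) = !![1, x; 0, 1] := rfl

@[simp] lemma lowerUnipotent_coe (x : ℝ) :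
    (lowerUnipotent x : Matrix (Fin 2) (Fin 2) ℝ) = !![1, 0; x, 1] := rfl

@[simp] lemma diagFlow_coe (t : ℝ) : (diagFlow t : Matrix (Fin 2) (Fin 2) ℝ) =
    !![Real.exp (t / 2), 0; 0, Real.exp (-(t / 2))] := rfl

lemma upperUnipotent_add (x y : ℝ) :
    upperUnipotent (x + y) = upperUnipotent x * upperUnipotent y := by
  ext i j
  fin_cases i <;> fin_cases j <;> simp [-Matrix.SpecialLinearGroup.coe_mul, mul_entry, add_comm]

lemma lowerUnipotent_add (x y : ℝ) :
    lowerUnipotent (x + y) = lowerUnipotent x * lowerUnipotent y := by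
  ext i j
  fin_cases i <;> fin_cases j <;> simp [-Matrix.SpecialLinearGroup.coe_mul, mul_entry]

lemma diagFlow_zero : diagFlow 0 = 1 := by
  ext i j
  fin_cases i <;> fin_cases j <;> simp

lemma diagFlow_add (s t : ℝ) : diagFlow (s + t) = diagFlow s * diagFlow t := by
  ext i j
  fin_cases i <;> fin_cases j <;>
    simp [-Matrix.SpecialLinearGroup.coe_mul, mul_entry, ← Real.exp_add] <;> ring

lemma diagFlow_conj_upperUnipotent (t x : ℝ) :
    diagFlow t * upperUnipotent x = upperUnipotent (Real.exp t * x) * diagFlow t := by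
  have h : Real.exp t * x * Real.exp (-(t / 2)) = Real.exp (t / 2) * x := by
    rw [mul_right_comm, ← Real.exp_add]
    ring_nf
  ext i j
  fin_cases i <;> fin_cases j <;> simp [-Matrix.SpecialLinearGroup.coe_mul, mul_entry, h]

lemma diagFlow_conj_lowerUnipotent (t x : ℝ) :
    diagFlow t * lowerUnipotent x = lowerUnipotent (Real.exp (-t) * x) * diagFlow t := by
  have h : Real.exp (-t) * x * Real.exp (t / 2) = Real.exp (-(t / 2)) * x := by
    rw [mul_right_comm, ← Real.exp_add]
    ring_nf
  ext i j
  fin_cases i <;> fin_cases j <;> simp [-Matrix.SpecialLinearGroup.coe_mul, mul_entry, h]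

/-- `SL(2, ℝ)` is generated by unipotent matrices. -/
lemma unipotent_induction {P : SL(2, ℝ) → Prop} (hu : ∀ x, P (upperUnipotent x))
    (hl : ∀ x, P (lowerUnipotent x)) (hm : ∀ g h, P g → P h → P (g * h)) (g : SL(2, ℝ)) : P g := by
  have key : ∀ g : SL(2, ℝ), g 1 0 ≠ 0 → P g := by
    intro g hg
    have hdet := g.det_coe
    rw [Matrix.det_fin_two] at hdet
    have : g = upperUnipotent ((g 0 0 - 1) / g 1 0) * lowerUnipotent (g 1 0) *
        upperUnipotent ((g 1 1 - 1) / g 1 0) := by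
      ext i j
      fin_cases i <;> fin_cases j <;> simp [-Matrix.SpecialLinearGroup.coe_mul, mul_entry] <;>
        field_simp <;> linarith
    rw [this]
    exact hm _ _ (hm _ _ (hu _) (hl _)) (hu _)
  by_cases h : g 1 0 = 0
  · have h1 : g = g * lowerUnipotent 1 * lowerUnipotent (-1) := by
      rw [mul_assoc, ← lowerUnipotent_add]
      have : lowerUnipotent (1 + -1) = 1 := by
        ext i j
        fin_cases i <;> fin_cases j <;> simp
      rw [this, mul_one]
    rw [h1]
    refine hm _ _ (key _ ?_) (hl _)
    have hdet := g.det_coe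
    rw [Matrix.det_fin_two, h] at hdet
    rw [mul_entry, h]
    intro h0
    simp at h0
    simp [h0] at hdet
  · exact key g h

/-! ### Topology of `SL(2, ℝ)` and unimodularity -/

instance : LocallyCompactSpace SL(2, ℝ) :=
  haveI : LocallyCompactSpace (Matrix (Fin 2) (Fin 2) ℝ) :=
    inferInstanceAs (LocallyCompactSpace (Fin 2 → Fin 2 → ℝ))
  Matrix.SpecialLinearGroup.isClosedEmbedding_val.locallyCompactSpace

instance : SecondCountableTopology SL(2, ℝ) :=
  haveI : SecondCountableTopology (Matrix (Fin 2) (Fin 2) ℝ) :=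
    inferInstanceAs (SecondCountableTopology (Fin 2 → Fin 2 → ℝ))
  Matrix.SpecialLinearGroup.isClosedEmbedding_val.isEmbedding.secondCountableTopology

instance : MeasurableSpace SL(2, ℝ) := borel _

instance : BorelSpace SL(2, ℝ) := ⟨rfl⟩

/-- A Haar measure on `SL(2, ℝ)`. -/
noncomputable def haarSL : Measure SL(2, ℝ) := Measure.haar

instance : haarSL.IsHaarMeasure := by unfold haarSL; infer_instance

instance : haarSL.Regular := by unfold haarSL; infer_instance

lemma continuous_entry (i j : Fin 2) : Continuous fun g : SL(2, ℝ) => g i j := by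
  have : Continuous fun g : SL(2, ℝ) => (g : Matrix (Fin 2) (Fin 2) ℝ) := continuous_subtype_val
  exact this.matrix_elem i j

lemma continuous_SL {X : Type*} [TopologicalSpace X] {f : X → SL(2, ℝ)}
    (h : ∀ i j, Continuous fun x => f x i j) : Continuous f :=
  Continuous.subtype_mk (continuous_matrix h) fun x => (f x).2

/-- Conjugation by `diagFlow (± log 2)` turns a unipotent `u` into `u * u`, so `Δ u = Δ u ^ 2` on
the generators. -/
lemma modularCharacterFun_eq_one (g : SL(2, ℝ)) : Measure.modularCharacterFun g = 1 := by
  set Δ : SL(2, ℝ) →* NNReal := Measure.modularCharacter with hΔ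
  have hpos : ∀ g, Δ g ≠ 0 := fun g => (Measure.modularCharacterFun_pos g).ne'
  change Δ g = 1
  have two : Real.exp (Real.log 2) = 2 := Real.exp_log two_pos
  have aux : ∀ {a b : NNReal}, a ≠ 0 → b ≠ 0 → a * b = b * b * a → b = 1 := by
    intro a b ha hb h
    have h2 : a * b * b = a * b * 1 := by rw [mul_one, mul_assoc, mul_comm, ← h]
    exact mul_left_cancel₀ (mul_ne_zero ha hb) h2
  induction g using unipotent_induction with
  | hu x =>
    have := congrArg Δ (diagFlow_conj_upperUnipotent (Real.log 2) x)
    rw [two, two_mul, upperUnipotent_add, map_mul, map_mul, map_mul] at this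
    exact aux (hpos _) (hpos _) this
  | hl x =>
    have := congrArg Δ (diagFlow_conj_lowerUnipotent (-Real.log 2) x)
    rw [neg_neg, two, two_mul, lowerUnipotent_add, map_mul, map_mul, map_mul] at this
    exact aux (hpos _) (hpos _) this
  | hm g h hg hh => rw [map_mul, hg, hh, mul_one]

instance : haarSL.IsMulRightInvariant := by
  refine ⟨fun g => ?_⟩
  rw [Measure.isMulLeftInvariant_eq_smul (Measure.map (· * g) haarSL) haarSL,
    ← Measure.modularCharacterFun_eq_haarScalarFactor, modularCharacterFun_eq_one, one_smul]

instance : haarSL.IsInvInvariant := by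
  constructor
  set c := Measure.haarScalarFactor haarSL.inv haarSL
  have hc : haarSL.inv = c • haarSL := Measure.isMulLeftInvariant_eq_smul _ _
  have h2 : haarSL = (c ^ 2) • haarSL := by
    conv_lhs => rw [← Measure.inv_inv haarSL, hc]
    rw [Measure.inv, Measure.map_smul, ← Measure.inv, hc, smul_smul, pow_two]
  have K : TopologicalSpace.PositiveCompacts SL(2, ℝ) := Classical.arbitrary _
  have h3 : (c : ENNReal) ^ 2 * haarSL K = 1 ^ 2 * haarSL K := by
    conv_rhs => rw [h2]
    simp [ENNReal.smul_def]
  have h4 : (c : ENNReal) ^ 2 = 1 ^ 2 :=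
    (ENNReal.mul_left_inj (Measure.measure_pos_of_nonempty_interior _ K.interior_nonempty).ne'
          K.isCompact.measure_lt_top.ne).1 h3
  have h5 : (c : ENNReal) = 1 := (ENNReal.pow_right_strictMono two_ne_zero).injective h4
  rw [hc, show c = 1 by exact_mod_cast h5, one_smul]

/-! ### Haar measure and hyperbolic area -/

lemma volume_upperHalfPlane_ne_zero : (volume : Measure ℍ) ≠ 0 := by
  intro h
  have hac : (volume : Measure ℂ).comap UpperHalfPlane.coe ≪ (volume : Measure ℍ) := by
    rw [UpperHalfPlane.volume_def]
    refine withDensity_absolutelyContinuous' ?_ (ae_of_all _ fun z => ?_)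
    · refine Continuous.aemeasurable ?_
      refine ENNReal.continuous_coe.comp ?_
      refine .pow (.div₀ continuous_const ?_ ?_) _
      · exact UpperHalfPlane.continuous_im.subtype_mk _
      · exact fun x ↦ NNReal.ne_iff.mp x.im_ne_zero
    · have : NNReal.mk z.im z.im_pos.le ≠ 0 := NNReal.ne_iff.mp z.im_ne_zero
      exact ENNReal.coe_ne_zero.2 (pow_ne_zero _ (div_ne_zero one_ne_zero this))
  have h0 : (volume : Measure ℂ).comap UpperHalfPlane.coe univ = 0 := hac (by simp [h])
  rw [UpperHalfPlane.measurableEmbedding_coe.comap_apply, image_univ] at h0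
  have hopen := UpperHalfPlane.isOpenEmbedding_coe.isOpen_range
  exact (hopen.measure_pos volume ⟨_, mem_range_self UpperHalfPlane.I⟩).ne' h0

instance : SMulInvariantMeasure SL(2, ℝ) ℍ volume :=
  ⟨fun g _ hs => measure_preimage_smul_of_nullMeasurableSet
    (G := GL (Fin 2) ℝ) (c := (g : GL (Fin 2) ℝ)) hs.nullMeasurableSet⟩

instance : MeasurableSMul₂ SL(2, ℝ) ℍ := ⟨continuous_smul.measurable⟩

lemma haarSL_setOf_inv_smul (w z : ℍ) (E : Set ℍ) :
    haarSL {g : SL(2, ℝ) | g⁻¹ • w ∈ E} = haarSL {g : SL(2, ℝ) | g • z ∈ E} := by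
  obtain ⟨k, rfl⟩ := MulAction.exists_smul_eq SL(2, ℝ) z w
  have h1 := measure_preimage_mul_right haarSL k {g : SL(2, ℝ) | g • z ∈ E}
  rw [← h1, ← Measure.measure_preimage_inv]
  congr 1
  ext g
  simp [mul_smul]

/-- Double counting: Fubini evaluates the integral over `g` of the area of `E ∩ g • E'`, which is
symmetric in `E` and `E'` after inverting `g`. -/
lemma volume_mul_haarSL_comm (z : ℍ) {E E' : Set ℍ} (hE : MeasurableSet E)
    (hE' : MeasurableSet E') :
    volume E * haarSL {g : SL(2, ℝ) | g • z ∈ E'} =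
      volume E' * haarSL {g : SL(2, ℝ) | g • z ∈ E} := by
  have key : ∀ {E E' : Set ℍ}, MeasurableSet E → MeasurableSet E' →
      ∫⁻ g : SL(2, ℝ), volume (E ∩ (fun w => g⁻¹ • w) ⁻¹' E') ∂haarSL =
        volume E * haarSL {g : SL(2, ℝ) | g • z ∈ E'} := by
    intro E E' hE hE'
    have hmeas : MeasurableSet {p : SL(2, ℝ) × ℍ | p.2 ∈ E ∧ p.1⁻¹ • p.2 ∈ E'} :=
      (measurable_snd hE).inter ((measurable_fst.inv.smul measurable_snd) hE')
    have h1 := Measure.prod_apply (μ := haarSL) (ν := (volume : Measure ℍ)) hmeas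
    have h2 := Measure.prod_apply_symm (μ := haarSL) (ν := (volume : Measure ℍ)) hmeas
    rw [h1] at h2
    refine h2.trans ?_
    have : ∀ w : ℍ, haarSL ((fun g : SL(2, ℝ) => (g, w)) ⁻¹'
        {p : SL(2, ℝ) × ℍ | p.2 ∈ E ∧ p.1⁻¹ • p.2 ∈ E'}) =
        E.indicator (fun _ => haarSL {g : SL(2, ℝ) | g • z ∈ E'}) w := by
      intro w
      by_cases hw : w ∈ E
      · simpa [hw] using haarSL_setOf_inv_smul w z E'
      · simp [hw]
    simp_rw [this]
    rw [lintegral_indicator_const hE, mul_comm]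
  rw [← key hE hE', ← key hE' hE, ← lintegral_inv_eq_self]
  refine lintegral_congr fun g => ?_
  rw [← measure_preimage_smul (μ := (volume : Measure ℍ)) g⁻¹]
  congr 1
  ext w
  simp [and_comm]

/-- The projection of the Haar measure to the upper half-plane is a finite multiple of the
hyperbolic area. -/
lemma exists_haarSL_preimage_smul (z : ℍ) : ∃ c : ENNReal, c ≠ ⊤ ∧
    ∀ E : Set ℍ, MeasurableSet E → haarSL {g : SL(2, ℝ) | g • z ∈ E} = c * volume E := by
  set B := Metric.closedBall z 1
  have hBm : MeasurableSet B := Metric.isClosed_closedBall.measurableSet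
  have hcont : Continuous fun g : SL(2, ℝ) => g • z := by fun_prop
  have hB0 : haarSL {g : SL(2, ℝ) | g • z ∈ B} ≠ 0 := by
    have : IsOpen {g : SL(2, ℝ) | g • z ∈ Metric.ball z 1} := Metric.isOpen_ball.preimage hcont
    refine ne_of_gt (lt_of_lt_of_le (this.measure_pos haarSL ⟨1, by simp⟩) (measure_mono ?_))
    intro g hg
    exact Metric.ball_subset_closedBall hg
  have hBtop : haarSL {g : SL(2, ℝ) | g • z ∈ B} ≠ ⊤ := by
    obtain ⟨k, hk⟩ := MulAction.exists_smul_eq SL(2, ℝ) UpperHalfPlane.I z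
    have h1 := measure_preimage_mul_right haarSL k {g : SL(2, ℝ) | g • UpperHalfPlane.I ∈ B}
    have h2 : (fun g => g * k) ⁻¹' {g : SL(2, ℝ) | g • UpperHalfPlane.I ∈ B} =
        {g : SL(2, ℝ) | g • z ∈ B} := by
      ext g
      simp [mul_smul, hk]
    rw [← h2, h1]
    exact (UpperHalfPlane.isProperMap_smul_I.isCompact_preimage
      (isCompact_closedBall z 1)).measure_lt_top.ne
  have hv0 : volume B ≠ 0 := by
    intro h0
    have := volume_mul_haarSL_comm z MeasurableSet.univ hBm
    rw [h0, zero_mul, mul_eq_zero, Measure.measure_univ_eq_zero] at this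
    exact this.elim volume_upperHalfPlane_ne_zero hB0
  have hvtop : volume B ≠ ⊤ := (isCompact_closedBall z 1).measure_lt_top.ne
  refine ⟨haarSL {g : SL(2, ℝ) | g • z ∈ B} / volume B, ENNReal.div_ne_top hBtop hv0,
    fun E hE => ?_⟩
  have := volume_mul_haarSL_comm z hE hBm
  rw [mul_comm, ← mul_div_assoc, this, mul_comm, ENNReal.mul_div_cancel_right hv0 hvtop]

/-! ### The finite measure carried by a fundamental domain -/

lemma countable_of_discrete (G : Subgroup SL(2, ℝ)) [DiscreteTopology G] : Countable G :=
  TopologicalSpace.separableSpace_iff_countable.1 inferInstance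

/-- A set of matrices is `G`-invariant if it is a union of right cosets `G g`. -/
def IsLeftInvariantSet (G : Subgroup SL(2, ℝ)) (E : Set SL(2, ℝ)) : Prop :=
  ∀ γ ∈ G, ∀ g, γ * g ∈ E ↔ g ∈ E

/-- A finite measure on `SL(2, ℝ)` which plays the role of the invariant measure of
`G \ SL(2, ℝ)`: the restriction of the Haar measure to a fundamental domain. -/
structure IsCovolumeMeasure (G : Subgroup SL(2, ℝ)) (μ : Measure SL(2, ℝ)) : Prop where
  le_haarSL : μ ≤ haarSL
  lt_top : μ univ < ⊤
  preimage_mul_right : ∀ E, MeasurableSet E → IsLeftInvariantSet G E →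
    ∀ h, μ {g | g * h ∈ E} = μ E
  haarSL_eq_zero : ∀ E, MeasurableSet E → IsLeftInvariantSet G E → μ E = 0 → haarSL E = 0
  -- `B` covers its image in the quotient at most `N` times; this turns an orbit count into a lower
  -- bound for quotient mass.
  haarSL_le : ∀ B E (N : ℕ), MeasurableSet B → MeasurableSet E → IsLeftInvariantSet G E → B ⊆ E →
    (∀ g, {γ | γ ∈ G ∧ γ * g ∈ B}.encard ≤ N) → haarSL B ≤ N * μ E

lemma quasiMeasurePreserving_smul (z : ℍ) :
    Measure.QuasiMeasurePreserving (fun g : SL(2, ℝ) => g • z) haarSL volume := by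
  have hm : Measurable fun g : SL(2, ℝ) => g • z := by fun_prop
  refine ⟨hm, Measure.AbsolutelyContinuous.mk fun E hE h0 => ?_⟩
  obtain ⟨c, -, hc⟩ := exists_haarSL_preimage_smul z
  rw [Measure.map_apply hm hE]
  exact (hc E hE).trans (by rw [h0, mul_zero])

section FundamentalDomain

variable {G : Subgroup SL(2, ℝ)} {F : Set ℍ}

instance [DiscreteTopology G] : Countable (MulAction.toPermHom G ℍ).range :=
  haveI := countable_of_discrete G
  (MulAction.toPermHom G ℍ).rangeRestrict_surjective.countable

lemma exists_mem_forall_smul_eq (σ : (MulAction.toPermHom G ℍ).range) :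
    ∃ γ ∈ G, ∀ z : ℍ, σ • z = γ • z := by
  obtain ⟨_, γ, rfl⟩ := σ
  exact ⟨γ, γ.2, fun z => rfl⟩

instance : MeasurableConstSMul (MulAction.toPermHom G ℍ).range ℍ := by
  refine ⟨fun σ => ?_⟩
  obtain ⟨γ, -, hγ⟩ := exists_mem_forall_smul_eq σ
  simp_rw [hγ]
  fun_prop

instance : SMulInvariantMeasure (MulAction.toPermHom G ℍ).range ℍ volume := by
  refine ⟨fun σ s hs => ?_⟩
  obtain ⟨γ, -, hγ⟩ := exists_mem_forall_smul_eq σ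
  simp_rw [hγ]
  exact SMulInvariantMeasure.measure_preimage_smul γ hs

/-- Right translation moves the base point, so independence of the base point yields right
invariance of the quotient measure. The image `ρ` in `ℍ × ℍ` is invariant under the diagonal action,
and `F` pulls back along either coordinate to a fundamental domain for it; two fundamental domains
have equal mass. -/
lemma haarSL_inter_smul_mem_eq [DiscreteTopology G]
    (hF : IsFundamentalDomain (MulAction.toPermHom G ℍ).range F volume)
    {E : Set SL(2, ℝ)} (hEG : IsLeftInvariantSet G E) (z w : ℍ) :
    haarSL.restrict E {g | g • z ∈ F} = haarSL.restrict E {g | g • w ∈ F} := by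
  have hm : Measurable fun g : SL(2, ℝ) => (g • z, g • w) := by fun_prop
  set ρ : Measure (ℍ × ℍ) := (haarSL.restrict E).map fun g => (g • z, g • w) with hρ
  have hinv : SMulInvariantMeasure (MulAction.toPermHom G ℍ).range (ℍ × ℍ) ρ := by
    refine ⟨fun σ s hs => ?_⟩
    obtain ⟨γ, hγG, hγ⟩ := exists_mem_forall_smul_eq σ
    have h1 : (fun p : ℍ × ℍ => σ • p) = fun p => γ • p := by
      ext1 p
      exact Prod.ext (hγ _) (hγ _)
    have hs' : MeasurableSet ((fun p : ℍ × ℍ => γ • p) ⁻¹' s) := measurable_const_smul γ hs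
    rw [h1, hρ, Measure.map_apply hm hs', Measure.map_apply hm hs,
      Measure.restrict_apply (hm hs'), Measure.restrict_apply (hm hs),
      ← measure_preimage_mul haarSL γ ((fun g => (g • z, g • w)) ⁻¹' s ∩ E)]
    congr 1
    ext g
    simp [mul_smul, hEG γ hγG g]
  have hsmul : MeasurableConstSMul (MulAction.toPermHom G ℍ).range (ℍ × ℍ) :=
    ⟨fun σ => ((measurable_const_smul σ).comp measurable_fst).prodMk
      ((measurable_const_smul σ).comp measurable_snd)⟩
  have hle : haarSL.restrict E ≪ haarSL := Measure.restrict_le_self.absolutelyContinuous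
  have h1 : Measure.QuasiMeasurePreserving (Prod.fst : ℍ × ℍ → ℍ) ρ volume := by
    refine ⟨measurable_fst, ?_⟩
    rw [hρ, Measure.map_map measurable_fst hm]
    exact ((quasiMeasurePreserving_smul z).mono_left hle).absolutelyContinuous
  have h2 : Measure.QuasiMeasurePreserving (Prod.snd : ℍ × ℍ → ℍ) ρ volume := by
    refine ⟨measurable_snd, ?_⟩
    rw [hρ, Measure.map_map measurable_snd hm]
    exact ((quasiMeasurePreserving_smul w).mono_left hle).absolutelyContinuous
  have f1 := hF.preimage_of_equiv h1 (e := id) Function.bijective_id (fun σ p => rfl)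
  have f2 := hF.preimage_of_equiv h2 (e := id) Function.bijective_id (fun σ p => rfl)
  have h3 := f1.measure_eq f2
  rwa [hρ, Measure.map_apply₀ hm.aemeasurable (hρ ▸ f1.nullMeasurableSet),
    Measure.map_apply₀ hm.aemeasurable (hρ ▸ f2.nullMeasurableSet)] at h3

/-- Cut `B` along the tiles `σ • F` and translate each piece back. The sum runs over transformations
of `ℍ`, not over matrices, so `-1` is not counted separately. -/
lemma haarSL_eq_tsum [DiscreteTopology G]
    (hF : IsFundamentalDomain (MulAction.toPermHom G ℍ).range F volume)
    {lift : (MulAction.toPermHom G ℍ).range → SL(2, ℝ)}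
    (hlift : ∀ σ, ∀ z : ℍ, σ • z = lift σ • z) {B : Set SL(2, ℝ)} (hB : MeasurableSet B) (z : ℍ) :
    haarSL B = ∑' σ, haarSL.restrict {g | g • z ∈ F} {g | lift σ * g ∈ B} := by
  have hm : Measurable fun g : SL(2, ℝ) => g • z := by fun_prop
  have hle : haarSL.restrict B ≪ haarSL := Measure.restrict_le_self.absolutelyContinuous
  have hac := ((quasiMeasurePreserving_smul z).mono_left hle).absolutelyContinuous
  have h1 := hF.lintegral_eq_tsum_of_ac hac (fun _ => 1)
  simp only [lintegral_const, one_mul, Measure.restrict_apply_univ,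
    Measure.map_apply hm MeasurableSet.univ, preimage_univ] at h1
  rw [h1]
  refine tsum_congr fun σ => ?_
  have hFσ : NullMeasurableSet (σ • F) volume := hF.nullMeasurableSet_smul σ
  rw [Measure.map_apply₀ hm.aemeasurable (hFσ.mono_ac hac),
    Measure.restrict_apply' hB,
    show {g | lift σ * g ∈ B} = (fun g => lift σ * g) ⁻¹' B from rfl,
    Measure.restrict_apply (measurable_const_mul (lift σ) hB),
    ← measure_preimage_mul haarSL (lift σ)]
  congr 1
  ext g
  simp only [mem_preimage, mem_inter_iff, mem_ofPred_eq, mul_smul, ← hlift, smul_mem_smul_set_iff]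
  tauto

lemma isCovolumeMeasure_restrict [DiscreteTopology G]
    (hF : IsFundamentalDomain (MulAction.toPermHom G ℍ).range F volume) (hvol : volume F < ⊤)
    (z : ℍ) : IsCovolumeMeasure G (haarSL.restrict {g | g • z ∈ F}) := by
  choose lift hliftG hlift using exists_mem_forall_smul_eq (G := G)
  refine ⟨Measure.restrict_le_self, ?_, fun E hE hEG h => ?_, fun E hE hEG h0 => ?_,
    fun B E N hB hE hEG hBE hN => ?_⟩
  · rw [Measure.restrict_apply_univ]
    obtain ⟨c, hc, hcE⟩ := exists_haarSL_preimage_smul z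
    calc haarSL {g | g • z ∈ F} ≤ haarSL {g | g • z ∈ toMeasurable volume F} :=
          measure_mono fun g hg => subset_toMeasurable _ _ hg
      _ = c * volume F := by rw [hcE _ (measurableSet_toMeasurable _ _), measure_toMeasurable]
      _ < ⊤ := ENNReal.mul_lt_top hc.lt_top hvol
  · change (haarSL.restrict {g | g • z ∈ F}) ((fun g => g * h) ⁻¹' E) = _
    rw [Measure.restrict_apply (measurable_mul_const h hE), Measure.restrict_apply hE,
      ← measure_preimage_mul_right haarSL h⁻¹]
    have h1 := haarSL_inter_smul_mem_eq hF hEG (h⁻¹ • z) z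
    rw [Measure.restrict_apply' hE, Measure.restrict_apply' hE] at h1
    rw [inter_comm E, ← h1]
    congr 1
    ext g
    simp [mul_smul, and_comm]
  · rw [haarSL_eq_tsum hF hlift hE z]
    refine ENNReal.tsum_eq_zero.2 fun σ => ?_
    rwa [show {g | lift σ * g ∈ E} = E from Set.ext fun g => hEG _ (hliftG σ) g]
  · set μ := haarSL.restrict {g | g • z ∈ F}
    have hmeas : ∀ σ, MeasurableSet {g | lift σ * g ∈ B} := fun σ =>
      measurable_const_mul (lift σ) hB
    have hinj : Function.Injective lift := by
      intro σ τ h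
      ext1
      ext1 w
      have := (hlift σ w).trans ((congrArg (· • w) h).trans (hlift τ w).symm)
      exact this
    calc haarSL B = ∑' σ, μ {g | lift σ * g ∈ B} := haarSL_eq_tsum hF hlift hB z
      _ = ∑' σ, ∫⁻ g, {g | lift σ * g ∈ B}.indicator 1 g ∂μ := by
          simp_rw [lintegral_indicator_one (hmeas _)]
      _ = ∫⁻ g, ∑' σ, {g | lift σ * g ∈ B}.indicator 1 g ∂μ :=
          (lintegral_tsum fun σ => (measurable_one.indicator (hmeas σ)).aemeasurable).symm
      _ ≤ ∫⁻ g, E.indicator (fun _ => (N : ENNReal)) g ∂μ := by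
          refine lintegral_mono fun g => ?_
          by_cases hg : g ∈ E
          · rw [indicator_of_mem hg]
            have : ∀ σ, {g | lift σ * g ∈ B}.indicator (1 : SL(2, ℝ) → ENNReal) g =
                {σ | lift σ * g ∈ B}.indicator 1 σ := fun σ => rfl
            simp_rw [this]
            rw [← tsum_subtype]
            simp only [Pi.one_apply, ENNReal.tsum_one]
            have h2 : ENat.card {σ | lift σ * g ∈ B} ≤ N := by
              refine le_trans ?_ (hN g)
              rw [← ENat.card_coe_set_eq]
              refine ENat.card_le_card_of_injective
                (f := fun σ : {σ | lift σ * g ∈ B} =>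
                  (⟨lift σ, hliftG σ, σ.2⟩ : {γ | γ ∈ G ∧ γ * g ∈ B})) ?_
              intro σ τ h
              exact Subtype.ext (hinj (congrArg Subtype.val h))
            exact_mod_cast h2
          · rw [indicator_of_notMem hg]
            refine le_of_eq (ENNReal.tsum_eq_zero.2 fun σ => indicator_of_notMem ?_ _)
            intro h
            exact hg ((hEG _ (hliftG σ) g).1 (hBE h))
      _ = N * μ E := lintegral_indicator_const hE _

end FundamentalDomain

/-! ### Ergodicity -/

section Ergodicity

variable {G : Subgroup SL(2, ℝ)} {μ : Measure SL(2, ℝ)} {E : Set SL(2, ℝ)}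

lemma IsLeftInvariantSet.diff {E' : Set SL(2, ℝ)} (h : IsLeftInvariantSet G E)
    (h' : IsLeftInvariantSet G E') : IsLeftInvariantSet G (E \ E') :=
  fun γ hγ g => and_congr (h γ hγ g) (not_congr (h' γ hγ g))

lemma IsLeftInvariantSet.preimage_mul_right (h : IsLeftInvariantSet G E) (k : SL(2, ℝ)) :
    IsLeftInvariantSet G ((· * k) ⁻¹' E) := by
  intro γ hγ g
  simp only [mem_preimage, mul_assoc]
  exact h γ hγ _

lemma tendsto_haarSL_symmDiff {X : Type*} [TopologicalSpace X] {f : X → SL(2, ℝ)} {x : X}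
    (hf : ContinuousAt f x) (hfx : f x = 1) {s : Set SL(2, ℝ)} (hs : MeasurableSet s)
    (hs' : haarSL s ≠ ⊤) :
    Tendsto (fun y => haarSL (symmDiff ((· * f y) ⁻¹' s) s)) (𝓝 x) (𝓝 0) := by
  let R : SL(2, ℝ) → C(SL(2, ℝ), SL(2, ℝ)) := fun h => ⟨fun g => g * h, by fun_prop⟩
  have hR : Continuous R := ContinuousMap.continuous_of_continuous_uncurry _
    (by simpa [R, Function.uncurry_def] using! continuous_snd.mul continuous_fst)
  have h1 : Tendsto (fun y => R (f y)) (𝓝 x) (𝓝 (R (f x))) :=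
    (hR.continuousAt.comp hf)
  have h2 := tendsto_measure_symmDiff_preimage_nhds_zero (μ := haarSL) (ν := haarSL) h1
    (Eventually.of_forall fun y => measurePreserving_mul_right haarSL (f y))
    (measurePreserving_mul_right haarSL (f x)) hs.nullMeasurableSet hs'
  simpa [R, hfx] using! h2

/-- Translation is continuous in Haar measure on sets of finite measure; a compact set carrying most
of `μ` reduces the claim to that case. -/
lemma IsCovolumeMeasure.tendsto_diff_preimage (hμ : IsCovolumeMeasure G μ)
    (hE : MeasurableSet E) {X : Type*} [TopologicalSpace X] {f : X → SL(2, ℝ)} {x : X}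
    (hf : ContinuousAt f x) (hfx : f x = 1) :
    Tendsto (fun y => μ (E \ (· * f y) ⁻¹' E)) (𝓝 x) (𝓝 0) := by
  have hfin : IsFiniteMeasure μ := ⟨hμ.lt_top⟩
  rw [ENNReal.tendsto_nhds_zero]
  intro ε hε
  have hε2 : 0 < ε / 2 := ENNReal.half_pos hε.ne'
  set K := compactCovering SL(2, ℝ)
  have hK : Tendsto (fun n => μ (K n)ᶜ) atTop (𝓝 0) := by
    have h1 := tendsto_measure_iInter_atTop (μ := μ) (s := fun n => (K n)ᶜ)
      (fun n => (isCompact_compactCovering _ n).measurableSet.compl.nullMeasurableSet)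
      (fun m n hmn => compl_subset_compl.2 (compactCovering_subset _ hmn))
      ⟨0, measure_ne_top _ _⟩
    rwa [← compl_iUnion, iUnion_compactCovering, compl_univ, measure_empty] at h1
  obtain ⟨n, hn⟩ := ((ENNReal.tendsto_nhds_zero.1 hK) _ hε2).exists
  obtain ⟨V, hVc, hV1⟩ := exists_compact_mem_nhds (1 : SL(2, ℝ))
  have hKV : IsCompact (K n * V) := (isCompact_compactCovering _ n).mul hVc
  have hs : MeasurableSet (E ∩ (K n * V)) := hE.inter hKV.measurableSet
  have hsf : haarSL (E ∩ (K n * V)) ≠ ⊤ :=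
    (lt_of_le_of_lt (measure_mono inter_subset_right) hKV.measure_lt_top).ne
  have h3 := (ENNReal.tendsto_nhds_zero.1 (tendsto_haarSL_symmDiff hf hfx hs hsf)) _ hε2
  have h4 : ∀ᶠ y in 𝓝 x, f y ∈ V := hf (hfx ▸ hV1)
  filter_upwards [h3, h4] with y hy hyV
  calc μ (E \ (· * f y) ⁻¹' E)
      ≤ μ ((K n)ᶜ ∪ symmDiff ((· * f y) ⁻¹' (E ∩ (K n * V))) (E ∩ (K n * V))) := by
        refine measure_mono fun g hg => ?_
        by_cases hgK : g ∈ K n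
        · refine Or.inr (Or.inr ⟨⟨hg.1, ?_⟩, fun h => hg.2 h.1⟩)
          exact ⟨g, hgK, 1, mem_of_mem_nhds hV1, mul_one g⟩
        · exact Or.inl hgK
    _ ≤ μ (K n)ᶜ + haarSL (symmDiff ((· * f y) ⁻¹' (E ∩ (K n * V))) (E ∩ (K n * V))) :=
        (measure_union_le _ _).trans (add_le_add_right (hμ.le_haarSL _) _)
    _ ≤ ε / 2 + ε / 2 := add_le_add hn hy
    _ = ε := ENNReal.add_halves ε

/-- Moore's ergodicity theorem for the action of `G` on the circle at infinity: an invariant set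
is null or conull. -/
lemma IsCovolumeMeasure.haarSL_eq_zero_or_compl (hμ : IsCovolumeMeasure G μ)
    (hE : MeasurableSet E) (hEG : IsLeftInvariantSet G E)
    (hu : ∀ x g, g * upperUnipotent x ∈ E ↔ g ∈ E) (hd : ∀ t g, g * diagFlow t ∈ E ↔ g ∈ E) :
    haarSL E = 0 ∨ haarSL Eᶜ = 0 := by
  have hpre : ∀ k, MeasurableSet ((· * k) ⁻¹' E) := fun k => measurable_mul_const k hE
  have key : ∀ h, haarSL (E \ (· * h) ⁻¹' E) = 0 := by
    intro h
    induction h using unipotent_induction with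
    | hu x => simp [show (· * upperUnipotent x) ⁻¹' E = E from Set.ext (hu x)]
    | hl x =>
      refine hμ.haarSL_eq_zero _ (hE.diff (hpre _)) (hEG.diff (hEG.preimage_mul_right _)) ?_
      -- Mautner's argument: the flow preserves `E` and contracts lower unipotents to `1`, so the
      -- defect is constant in `t` and yet tends to `0`.
      have hconst : ∀ t, μ (E \ (· * lowerUnipotent (Real.exp (-t) * x)) ⁻¹' E) =
          μ (E \ (· * lowerUnipotent x) ⁻¹' E) := by
        intro t
        rw [← hμ.preimage_mul_right _ (hE.diff (hpre (lowerUnipotent x)))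
          (hEG.diff (hEG.preimage_mul_right _)) (diagFlow t)]
        congr 1
        ext g
        simp only [Set.mem_sdiff, mem_preimage, mem_ofPred_eq]
        rw [hd, mul_assoc g, diagFlow_conj_lowerUnipotent, ← mul_assoc, hd]
      have hcont : Continuous lowerUnipotent := continuous_SL fun i j => by
        fin_cases i <;> fin_cases j <;> simp <;> fun_prop
      have h0 : lowerUnipotent 0 = 1 := by
        ext i j
        fin_cases i <;> fin_cases j <;> simp
      have h1 := hμ.tendsto_diff_preimage hE hcont.continuousAt h0
      have h2 : Tendsto (fun t : ℝ => Real.exp (-t) * x) atTop (𝓝 0) := by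
        simpa using (Real.tendsto_exp_neg_atTop_nhds_zero.mul_const x)
      have h3 := h1.comp h2
      simp only [Function.comp_def, hconst] at h3
      exact tendsto_nhds_unique tendsto_const_nhds h3
    | hm g h hg hh =>
      refine measure_mono_null (t := (E \ (· * g) ⁻¹' E) ∪ (· * g) ⁻¹' (E \ (· * h) ⁻¹' E)) ?_
        (measure_union_null hg ((measure_preimage_mul_right haarSL g _).trans hh))
      intro k hk
      by_cases hkg : k * g ∈ E
      · refine Or.inr ⟨hkg, fun h' => hk.2 ?_⟩
        simpa [mul_assoc] using h'
      · exact Or.inl ⟨hk.1, hkg⟩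
  rw [or_iff_not_imp_left]
  intro hE0
  have hmeas : MeasurableSet {p : SL(2, ℝ) × SL(2, ℝ) | p.2 ∈ E ∧ p.2 * p.1 ∉ E} :=
    (measurable_snd hE).inter ((measurable_snd.mul measurable_fst) hE.compl)
  have h1 : (haarSL.prod haarSL) {p : SL(2, ℝ) × SL(2, ℝ) | p.2 ∈ E ∧ p.2 * p.1 ∉ E} = 0 := by
    rw [Measure.measure_prod_null hmeas]
    exact ae_of_all _ key
  rw [Measure.prod_apply_symm hmeas, lintegral_eq_zero_iff (measurable_measure_prodMk_right hmeas)]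
    at h1
  -- A point of `E` almost all of whose right translates stay in `E`; these translates fill the
  -- group up to a null set.
  obtain ⟨g, hgE, hg⟩ : ∃ g ∈ E, haarSL ((fun h => (h, g)) ⁻¹'
      {p : SL(2, ℝ) × SL(2, ℝ) | p.2 ∈ E ∧ p.2 * p.1 ∉ E}) = 0 := by
    by_contra! hcon
    exact hE0 (measure_mono_null (fun g hg => hcon g hg) h1)
  rw [← measure_preimage_mul haarSL g]
  refine measure_mono_null (fun h hh => ?_) hg
  exact ⟨hgE, hh⟩

end Ergodicity

/-! ### Maximal ergodic theorem -/

lemma IsCovolumeMeasure.integral_comp_mul_right {G : Subgroup SL(2, ℝ)} {μ : Measure SL(2, ℝ)}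
    (hμ : IsCovolumeMeasure G μ) {f : SL(2, ℝ) → ℝ} (hf : Measurable f)
    (hfG : ∀ γ ∈ G, ∀ g, f (γ * g) = f g) (h : SL(2, ℝ)) :
    ∫ g, f (g * h) ∂μ = ∫ g, f g ∂μ := by
  have hm : Measurable fun g => f (g * h) := hf.comp (measurable_mul_const h)
  have : ProbabilityTheory.IdentDistrib (fun g => f (g * h)) f μ μ := by
    refine ⟨hm.aemeasurable, hf.aemeasurable, ?_⟩
    ext s hs
    rw [Measure.map_apply hm hs, Measure.map_apply hf hs]
    refine hμ.preimage_mul_right _ (hf hs) (fun γ hγ g => ?_) h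
    simp [hfG γ hγ g]
  exact this.integral_eq

/-- Partial maximum of the Birkhoff sums: `max (0, f, f + f ∘ T, …)` with `n` steps. -/
noncomputable def birkhoffMax {α : Type*} (T : α → α) (f : α → ℝ) : ℕ → α → ℝ
  | 0, _ => 0
  | n + 1, x => max 0 (f x + birkhoffMax T f n (T x))

lemma birkhoffMax_nonneg {α : Type*} (T : α → α) (f : α → ℝ) (n : ℕ) (x : α) :
    0 ≤ birkhoffMax T f n x := by
  cases n <;> simp [birkhoffMax]

lemma birkhoffMax_le_succ {α : Type*} (T : α → α) (f : α → ℝ) (n : ℕ) (x : α) :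
    birkhoffMax T f n x ≤ birkhoffMax T f (n + 1) x := by
  induction n generalizing x with
  | zero => exact birkhoffMax_nonneg _ _ _ _
  | succ n ih => exact max_le_max le_rfl (by gcongr; exact ih _)

lemma birkhoffSum_le_birkhoffMax {α : Type*} (T : α → α) (f : α → ℝ) (n : ℕ) (x : α) :
    birkhoffSum T f n x ≤ birkhoffMax T f n x := by
  induction n generalizing x with
  | zero => simp [birkhoffMax]
  | succ n ih =>
    rw [birkhoffSum_succ']
    exact (add_le_add_right (ih _) _).trans (le_max_right _ _)

/-- Maximal ergodic theorem: if some Birkhoff sum of `f` is positive almost everywhere, then `f`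
has nonnegative integral. -/
lemma IsCovolumeMeasure.integral_nonneg_of_birkhoffSum_pos {G : Subgroup SL(2, ℝ)}
    {μ : Measure SL(2, ℝ)} (hμ : IsCovolumeMeasure G μ) {f : SL(2, ℝ) → ℝ} (hf : Measurable f)
    (hfG : ∀ γ ∈ G, ∀ g, f (γ * g) = f g) {C : ℝ} (hfC : ∀ g, |f g| ≤ C) (h : SL(2, ℝ))
    (hpos : ∀ᵐ g ∂μ, ∃ n, 0 < birkhoffSum (· * h) f n g) : 0 ≤ ∫ g, f g ∂μ := by
  have hfin : IsFiniteMeasure μ := ⟨hμ.lt_top⟩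
  set m := birkhoffMax (· * h) f with hm_def
  have hmeas : ∀ n, Measurable (m n) := by
    intro n
    induction n with
    | zero => exact measurable_const
    | succ n ih => exact measurable_const.max (hf.add (ih.comp (measurable_mul_const h)))
  have hinv : ∀ n, ∀ γ ∈ G, ∀ g, m n (γ * g) = m n g := by
    intro n γ hγ
    induction n with
    | zero => exact fun g => rfl
    | succ n ih =>
      intro g
      simp only [hm_def, birkhoffMax, hfG γ hγ g, mul_assoc]
      simp only [← hm_def, ih]
  have hbdd : ∀ n g, |m n g| ≤ n * C := by
    intro n
    induction n with
    | zero => intro g; simp [hm_def, birkhoffMax]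
    | succ n ih =>
      intro g
      have h1 := abs_le.1 (hfC g)
      have h2 := abs_le.1 (ih (g * h))
      rw [abs_of_nonneg (birkhoffMax_nonneg _ _ _ _)]
      refine max_le ?_ ?_
      · have := (abs_nonneg _).trans (hfC g)
        positivity
      · push_cast
        simp only [← hm_def]
        linarith [h1.2, h2.2]
  have hintm : ∀ n, Integrable (m n) μ := fun n =>
    Integrable.of_bound (hmeas n).aestronglyMeasurable (n * C) (ae_of_all _ (hbdd n))
  have hintf : Integrable f μ :=
    Integrable.of_bound hf.aestronglyMeasurable C (ae_of_all _ hfC)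
  have hintmT : ∀ n, Integrable (fun g => m n (g * h)) μ := fun n =>
    Integrable.of_bound ((hmeas n).comp (measurable_mul_const h)).aestronglyMeasurable (n * C)
      (ae_of_all _ fun g => hbdd n _)
  have hset : ∀ n, MeasurableSet {g | 0 < m n g} := fun n =>
    measurableSet_lt measurable_const (hmeas n)
  have hmain : ∀ n, 0 ≤ ∫ g in {g | 0 < m n g}, f g ∂μ := by
    intro n
    -- Garsia's argument: where `m n` is positive, so is `m (n + 1)`, which therefore equals `f + m
    -- n ∘ T` there. The left side has integral `0` by invariance.
    have h1 : ∀ g, m n g - m n (g * h) ≤ {g | 0 < m n g}.indicator f g := by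
      intro g
      by_cases hg : 0 < m n g
      · rw [indicator_of_mem (show g ∈ {g | 0 < m n g} from hg)]
        have h2 : m n g ≤ m (n + 1) g := birkhoffMax_le_succ _ _ _ _
        have h3 : m (n + 1) g = max 0 (f g + m n (g * h)) := rfl
        rcases max_choice 0 (f g + m n (g * h)) with h4 | h4 <;> rw [h3, h4] at h2 <;> linarith
      · rw [indicator_of_notMem (show g ∉ {g | 0 < m n g} from hg)]
        have := birkhoffMax_nonneg (· * h) f n (g * h)
        simp only [← hm_def] at this
        linarith
    rw [← integral_indicator (hset n)]
    calc (0 : ℝ) = ∫ g, (m n g - m n (g * h)) ∂μ := by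
          rw [integral_sub (hintm n) (hintmT n),
            hμ.integral_comp_mul_right (hmeas n) (hinv n) h, sub_self]
      _ ≤ _ := integral_mono ((hintm n).sub (hintmT n)) (hintf.indicator (hset n)) h1
  have hmono : Monotone fun n => {g | 0 < m n g} :=
    monotone_nat_of_le_succ fun n g hg => lt_of_lt_of_le hg (birkhoffMax_le_succ _ _ _ _)
  have hlim := tendsto_setIntegral_of_monotone hset hmono hintf.integrableOn
  have hU : (⋃ n, {g | 0 < m n g}) =ᵐ[μ] univ := by
    rw [eventuallyEq_univ]
    filter_upwards [hpos] with g ⟨n, hn⟩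
    exact mem_iUnion.2 ⟨n, lt_of_lt_of_le hn (birkhoffSum_le_birkhoffMax _ _ _ _)⟩
  rw [setIntegral_congr_set hU, setIntegral_univ] at hlim
  exact ge_of_tendsto' hlim hmain

/-! ### Columns of a matrix and heights -/

/-- The squared length of the `j`-th column of `m`. -/
def colSq (m : SL(2, ℝ)) (j : Fin 2) : ℝ := m 0 j ^ 2 + m 1 j ^ 2

/-- The squared Frobenius norm of `m`. -/
def frobSq (m : SL(2, ℝ)) : ℝ := colSq m 0 + colSq m 1

/-- The logarithm of the modulus of `m⁻¹ • i`. -/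
noncomputable def logModulus (m : SL(2, ℝ)) : ℝ := (Real.log (colSq m 1) - Real.log (colSq m 0)) / 2

lemma det_eq_one (m : SL(2, ℝ)) : m 0 0 * m 1 1 - m 0 1 * m 1 0 = 1 := by
  have h := m.det_coe
  rwa [Matrix.det_fin_two] at h

lemma colSq_nonneg (m : SL(2, ℝ)) (j : Fin 2) : 0 ≤ colSq m j := by
  unfold colSq
  positivity

lemma one_le_colSq_mul_colSq (m : SL(2, ℝ)) : 1 ≤ colSq m 0 * colSq m 1 := by
  have h := det_eq_one m
  have : colSq m 0 * colSq m 1 =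
      (m 0 0 * m 1 1 - m 0 1 * m 1 0) ^ 2 + (m 0 0 * m 0 1 + m 1 0 * m 1 1) ^ 2 := by
    unfold colSq
    ring
  rw [this, h]
  nlinarith [sq_nonneg (m 0 0 * m 0 1 + m 1 0 * m 1 1)]

lemma colSq_pos (m : SL(2, ℝ)) (j : Fin 2) : 0 < colSq m j := by
  have h := one_le_colSq_mul_colSq m
  refine (colSq_nonneg m j).lt_of_ne fun h0 => ?_
  fin_cases j <;> simp at h0 <;> rw [← h0] at h <;> norm_num at h

lemma colSq_mul_le (s m : SL(2, ℝ)) (j : Fin 2) : colSq (s * m) j ≤ frobSq s * colSq m j := by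
  simp only [colSq, frobSq, mul_entry]
  nlinarith [sq_nonneg (s 0 0 * m 1 j - s 0 1 * m 0 j), sq_nonneg (s 1 0 * m 1 j - s 1 1 * m 0 j)]

lemma frobSq_inv (s : SL(2, ℝ)) : frobSq s⁻¹ = frobSq s := by
  rw [Matrix.SpecialLinearGroup.SL2_inv_expl]
  simp [frobSq, colSq]
  ring

lemma two_le_frobSq (s : SL(2, ℝ)) : 2 ≤ frobSq s := by
  have h := one_le_colSq_mul_colSq s
  unfold frobSq
  nlinarith [sq_nonneg (colSq s 0 - colSq s 1), colSq_nonneg s 0, colSq_nonneg s 1]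

lemma colSq_le_mul (s m : SL(2, ℝ)) (j : Fin 2) : colSq m j ≤ frobSq s * colSq (s * m) j := by
  have := colSq_mul_le s⁻¹ (s * m) j
  rwa [inv_mul_cancel_left, frobSq_inv] at this

/-- The difference has degree four in `m` but is divisible by `det m = 1`; the quotient is only
quadratic, which saves one factor of the square root. The bounds on `p` and `q` come from `p ^ 2 + q
^ 2 = colSq m 0 * colSq m 1`. -/
lemma abs_colSq_cross_le (s m : SL(2, ℝ)) :
    |colSq (s * m) 1 * colSq m 0 - colSq (s * m) 0 * colSq m 1| ≤
      2 * frobSq s * √(colSq m 0 * colSq m 1) := by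
  set N := frobSq s with hN
  set r := √(colSq m 0 * colSq m 1) with hr
  set p := m 0 0 * m 1 1 + m 0 1 * m 1 0 with hp
  set q := m 0 0 * m 0 1 - m 1 0 * m 1 1 with hq
  have hX : colSq (s * m) 1 * colSq m 0 - colSq (s * m) 0 * colSq m 1 =
      (colSq s 1 - colSq s 0) * p + 2 * (s 0 0 * s 0 1 + s 1 0 * s 1 1) * q := by
    have h : colSq (s * m) 1 * colSq m 0 - colSq (s * m) 0 * colSq m 1 =
      ((colSq s 1 - colSq s 0) * p + 2 * (s 0 0 * s 0 1 + s 1 0 * s 1 1) * q) *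
        (m 0 0 * m 1 1 - m 0 1 * m 1 0) := by
      simp only [colSq, mul_entry, hp, hq]
      ring
    rw [h, det_eq_one, mul_one]
  have h1 : |p| ≤ r := by
    refine Real.abs_le_sqrt ?_
    simp only [colSq, hp]
    nlinarith [sq_nonneg (m 0 0 * m 0 1 - m 1 0 * m 1 1)]
  have h2 : |q| ≤ r := by
    refine Real.abs_le_sqrt ?_
    simp only [colSq, hq]
    nlinarith [sq_nonneg (m 0 0 * m 1 1 + m 1 0 * m 0 1)]
  have h3 : |colSq s 1 - colSq s 0| ≤ N := by
    rw [abs_le, hN, frobSq]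
    constructor <;> linarith [colSq_nonneg s 0, colSq_nonneg s 1]
  have h4 : |2 * (s 0 0 * s 0 1 + s 1 0 * s 1 1)| ≤ N := by
    rw [abs_le, hN, frobSq, colSq, colSq]
    constructor <;> nlinarith [sq_nonneg (s 0 0 + s 0 1), sq_nonneg (s 1 0 + s 1 1),
      sq_nonneg (s 0 0 - s 0 1), sq_nonneg (s 1 0 - s 1 1)]
  have hN0 : 0 ≤ N := (abs_nonneg _).trans h3
  calc |colSq (s * m) 1 * colSq m 0 - colSq (s * m) 0 * colSq m 1|
      ≤ |(colSq s 1 - colSq s 0) * p| + |2 * (s 0 0 * s 0 1 + s 1 0 * s 1 1) * q| := by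
        rw [hX]
        exact abs_add_le _ _
    _ ≤ N * r + N * r := by
        rw [abs_mul, abs_mul]
        gcongr
    _ = 2 * N * r := by ring

/-- The square root is `cosh` of the distance from `i` to the geodesic of `m`, and `logModulus m` is
the time of closest approach. Far from a geodesic, a bounded step hardly moves the foot of the
perpendicular. -/
lemma abs_logModulus_mul_sub_le (s m : SL(2, ℝ)) :
    |logModulus (s * m) - logModulus m| ≤ frobSq s ^ 2 / √(colSq m 0 * colSq m 1) := by
  have hA := colSq_pos m 0
  have hB := colSq_pos m 1
  have hA' := colSq_pos (s * m) 0
  have hB' := colSq_pos (s * m) 1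
  have hX := abs_le.1 (abs_colSq_cross_le s m)
  have hAle := colSq_le_mul s m 0
  have hBle := colSq_le_mul s m 1
  have hN : 0 < frobSq s := two_pos.trans_le (two_le_frobSq s)
  set A := colSq m 0
  set B := colSq m 1
  set A' := colSq (s * m) 0
  set B' := colSq (s * m) 1
  set N := frobSq s
  set r := √(A * B) with hr
  have hr0 : 0 < r := Real.sqrt_pos.2 (mul_pos hA hB)
  have hr2 : r * r = A * B := Real.mul_self_sqrt (mul_pos hA hB).le
  have key : ∀ {x y : ℝ}, 0 < x → 0 < y → y - x ≤ 2 * N * r → r * r ≤ N * x →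
      (Real.log y - Real.log x) ≤ 2 * (N ^ 2 / r) := by
    intro x y hx hy h1 h2
    rw [← Real.log_div hy.ne' hx.ne']
    refine (Real.log_le_sub_one_of_pos (div_pos hy hx)).trans ?_
    rw [div_sub_one hx.ne', div_le_iff₀ hx]
    have h3 : 2 * N * r * r ≤ 2 * N * (N * x) := by
      rw [mul_assoc (2 * N)]
      gcongr
    rw [show 2 * (N ^ 2 / r) * x = (2 * N * (N * x)) / r by ring, le_div_iff₀ hr0]
    nlinarith
  have h1 := key (x := A' * B) (y := B' * A) (by positivity) (by positivity) (by linarith)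
    (by rw [hr2]; nlinarith)
  have h2 := key (x := B' * A) (y := A' * B) (by positivity) (by positivity) (by linarith)
    (by rw [hr2]; nlinarith)
  rw [Real.log_mul hA'.ne' hB.ne', Real.log_mul hB'.ne' hA.ne'] at h1 h2
  rw [abs_le, logModulus, logModulus]
  constructor <;> linarith

lemma colSq_mul_diagFlow (m : SL(2, ℝ)) (t : ℝ) :
    colSq (m * diagFlow t) 0 = Real.exp t * colSq m 0 ∧
      colSq (m * diagFlow t) 1 = Real.exp (-t) * colSq m 1 := by
  have h1 : Real.exp t = Real.exp (t / 2) ^ 2 := by rw [← Real.exp_nat_mul]; ring_nf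
  have h2 : Real.exp (-t) = Real.exp (-(t / 2)) ^ 2 := by rw [← Real.exp_nat_mul]; ring_nf
  constructor <;> simp [colSq, -Matrix.SpecialLinearGroup.coe_mul, mul_entry, h1, h2] <;> ring

/-- At time `logModulus m` both columns have squared length `√(colSq m 0 * colSq m 1)`; a delay of
at most `κ` costs a factor `exp κ`. -/
lemma frobSq_mul_diagFlow_le (m : SL(2, ℝ)) {t κ : ℝ} (ht : |t - logModulus m| ≤ κ) :
    frobSq (m * diagFlow t) ≤ 2 * √(colSq m 0 * colSq m 1) * Real.exp κ := by
  have hA := colSq_pos m 0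
  have hB := colSq_pos m 1
  obtain ⟨h1, h2⟩ := colSq_mul_diagFlow m t
  have ht' := abs_le.1 ht
  have hs : √(colSq m 0 * colSq m 1) =
      Real.exp ((Real.log (colSq m 0) + Real.log (colSq m 1)) / 2) := by
    rw [← Real.log_mul hA.ne' hB.ne', ← Real.log_sqrt (by positivity),
      Real.exp_log (Real.sqrt_pos.2 (by positivity))]
  have h3 : Real.exp t * colSq m 0 ≤ √(colSq m 0 * colSq m 1) * Real.exp κ := by
    rw [hs]
    nth_rewrite 1 [← Real.exp_log hA]
    rw [← Real.exp_add, ← Real.exp_add, Real.exp_le_exp]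
    unfold logModulus at ht'
    linarith
  have h4 : Real.exp (-t) * colSq m 1 ≤ √(colSq m 0 * colSq m 1) * Real.exp κ := by
    rw [hs]
    nth_rewrite 1 [← Real.exp_log hB]
    rw [← Real.exp_add, ← Real.exp_add, Real.exp_le_exp]
    unfold logModulus at ht'
    linarith
  rw [frobSq, h1, h2]
  linarith

lemma neg_log_colSq_le_logModulus (m : SL(2, ℝ)) : -Real.log (colSq m 0) ≤ logModulus m := by
  have h := Real.log_nonneg (one_le_colSq_mul_colSq m)
  rw [Real.log_mul (colSq_pos m 0).ne' (colSq_pos m 1).ne'] at h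
  unfold logModulus
  linarith

/-! ### Word length and geodesics -/

section Words

variable {G : Subgroup SL(2, ℝ)} {S : Set G} {φ : SL(2, ℝ) → ℝ}

/-- The interval has length of order `1 / r` and the weight on it is of order `r`, so the distance
to the geodesic cancels. -/
lemma abs_intervalIntegral_logModulus_le (hφ0 : ∀ g, 0 ≤ φ g)
    (hφ : ∀ γ ∈ G, ∀ g, φ g ≤ frobSq (γ * g)) {P : SL(2, ℝ)} (hP : P ∈ G) (s h : SL(2, ℝ)) :
    |∫ t in logModulus (P * h)..logModulus (s * (P * h)), φ (h * diagFlow t)| ≤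
      2 * frobSq s ^ 2 * Real.exp (frobSq s ^ 2) := by
  set m := P * h
  set r := √(colSq m 0 * colSq m 1)
  have hr1 : 1 ≤ r := Real.one_le_sqrt.2 (one_le_colSq_mul_colSq m)
  have hL := abs_logModulus_mul_sub_le s m
  have hL' : |logModulus (s * m) - logModulus m| ≤ frobSq s ^ 2 :=
    hL.trans (div_le_self (sq_nonneg _) hr1)
  have hb : ∀ t ∈ uIoc (logModulus m) (logModulus (s * m)),
      ‖φ (h * diagFlow t)‖ ≤ 2 * r * Real.exp (frobSq s ^ 2) := by
    intro t ht
    rw [Real.norm_of_nonneg (hφ0 _)]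
    refine (hφ P hP _).trans ?_
    rw [← mul_assoc]
    refine frobSq_mul_diagFlow_le m (le_trans ?_ hL')
    exact abs_sub_left_of_mem_uIcc (uIoc_subset_uIcc ht)
  have h1 := intervalIntegral.norm_integral_le_of_norm_le_const hb
  rw [Real.norm_eq_abs] at h1
  refine h1.trans ?_
  calc 2 * r * Real.exp (frobSq s ^ 2) * |logModulus (s * m) - logModulus m|
      ≤ 2 * r * Real.exp (frobSq s ^ 2) * (frobSq s ^ 2 / r) := by gcongr
    _ = 2 * frobSq s ^ 2 * Real.exp (frobSq s ^ 2) := by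
        have : r ≠ 0 := by positivity
        field_simp

lemma intervalIntegrable_flow (hφm : Measurable φ) {M : ℝ} (hφM : ∀ g, |φ g| ≤ M)
    (h : SL(2, ℝ)) (a b : ℝ) :
    IntervalIntegrable (fun t => φ (h * diagFlow t)) volume a b := by
  have hc : Continuous diagFlow := continuous_SL fun i j => by
    fin_cases i <;> fin_cases j <;> simp <;> fun_prop
  have hm : Measurable fun t => φ (h * diagFlow t) :=
    hφm.comp (hc.measurable.const_mul h)
  rw [intervalIntegrable_iff]
  have : IsFiniteMeasure (volume.restrict (uIoc a b)) :=
    ⟨by rw [Measure.restrict_apply_univ, uIoc]; exact measure_Ioc_lt_top⟩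
  exact Integrable.of_bound hm.aestronglyMeasurable M (ae_of_all _ fun t => hφM _)

lemma intervalIntegral_le_mul_length (hφm : Measurable φ) {M : ℝ} (hφM : ∀ g, φ g ≤ M)
    (hφ0 : ∀ g, 0 ≤ φ g) (hφ : ∀ γ ∈ G, ∀ g, φ g ≤ frobSq (γ * g)) {C : ℝ}
    (hC : ∀ s : G, s ∈ S ∨ s⁻¹ ∈ S → 2 * frobSq s ^ 2 * Real.exp (frobSq s ^ 2) ≤ C)
    (h : SL(2, ℝ)) (l : List G) (hl : ∀ s ∈ l, s ∈ S ∨ s⁻¹ ∈ S) :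
    ∫ t in logModulus h..logModulus ((l.prod : G) * h), φ (h * diagFlow t) ≤ C * l.length := by
  have hint := intervalIntegrable_flow hφm (fun g => by rw [abs_of_nonneg (hφ0 g)]; exact hφM g) h
  induction l with
  | nil => simp
  | cons s l ih =>
    have h1 := ih fun s hs => hl s (List.mem_cons_of_mem _ hs)
    have h2 := (abs_le.1 (abs_intervalIntegral_logModulus_le hφ0 hφ l.prod.2 s h)).2
    have h3 := hC s (hl s List.mem_cons_self)
    rw [List.prod_cons, Subgroup.coe_mul, mul_assoc, List.length_cons,
      ← intervalIntegral.integral_add_adjacent_intervals (hint _ (logModulus (l.prod * h)))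
        (hint _ _)]
    rw [Nat.cast_succ]
    linarith

/-! ### Balls in the word metric and the expanding set -/

lemma exists_mem_wordBall (hS : Subgroup.closure S = ⊤) (γ : G) : ∃ n, γ ∈ wordBall S n := by
  have : γ ∈ (Subgroup.closure S).toSubmonoid := hS ▸ Subgroup.mem_top γ
  rw [Subgroup.closure_toSubmonoid] at this
  obtain ⟨l, hl, rfl⟩ := Submonoid.exists_list_of_mem_closure this
  exact ⟨l.length, l, le_rfl, hl, rfl⟩

lemma mul_mem_wordBall {g γ : G} {n k : ℕ} (hg : g ∈ wordBall S n) (hγ : γ ∈ wordBall S k) :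
    g * γ ∈ wordBall S (n + k) := by
  obtain ⟨l, h1, h2, rfl⟩ := hg
  obtain ⟨l', h1', h2', rfl⟩ := hγ
  refine ⟨l ++ l', by rw [List.length_append]; omega, fun s hs => ?_, List.prod_append⟩
  exact (List.mem_append.1 hs).elim (h2 s) (h2' s)

/-- The frames `h` such that `log |g'|` at the boundary point `h • ∞` exceeds `ε` times the
word length of `g` by an arbitrarily large amount. -/
def expandingSet (S : Set G) (ε : ℝ) : Set SL(2, ℝ) :=
  {h | ∀ J : ℕ, ∃ n : ℕ, ∃ g ∈ wordBall S n,
    ε * n + J < Real.log (colSq h 0) - Real.log (colSq (g * h) 0)}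

lemma continuous_colSq (j : Fin 2) : Continuous fun g => colSq g j :=
  ((continuous_entry 0 j).pow 2).add ((continuous_entry 1 j).pow 2)

lemma measurableSet_expandingSet [Countable G] (S : Set G) (ε : ℝ) :
    MeasurableSet (expandingSet S ε) := by
  have : expandingSet S ε = ⋂ J : ℕ, ⋃ n : ℕ, ⋃ g ∈ wordBall S n,
      {h | ε * n + J < Real.log (colSq h 0) - Real.log (colSq (g * h) 0)} := by
    ext h
    simp [expandingSet]
  rw [this]
  refine MeasurableSet.iInter fun J => MeasurableSet.iUnion fun n =>
    MeasurableSet.biUnion (to_countable _) fun g _ => ?_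
  have h1 := (continuous_colSq 0).measurable
  exact measurableSet_lt measurable_const
    (h1.log.sub (h1.comp (measurable_const_mul (g : SL(2, ℝ)))).log)

/-- The arbitrary surplus `J` serves this purpose: replacing `h` by `γ * h` and `g` by `g * γ⁻¹`
changes both sides by amounts independent of `g`. -/
lemma isLeftInvariantSet_expandingSet (hS : Subgroup.closure S = ⊤) (ε : ℝ) :
    IsLeftInvariantSet G (expandingSet S ε) := by
  have key : ∀ γ ∈ G, ∀ h, h ∈ expandingSet S ε → γ * h ∈ expandingSet S ε := by
    intro γ hγ h hh J
    obtain ⟨k, hk⟩ := exists_mem_wordBall hS (⟨γ, hγ⟩ : G)⁻¹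
    obtain ⟨J', hJ'⟩ :=
      exists_nat_ge (J + (ε * k + Real.log (colSq h 0) - Real.log (colSq (γ * h) 0)))
    obtain ⟨n, g, hg, hlt⟩ := hh J'
    refine ⟨n + k, g * (⟨γ, hγ⟩ : G)⁻¹, mul_mem_wordBall hg hk, ?_⟩
    have : ((g * (⟨γ, hγ⟩ : G)⁻¹ : G) : SL(2, ℝ)) * (γ * h) = g * h := by
      simp [mul_assoc]
    rw [this]
    push_cast
    linarith
  refine fun γ hγ h => ⟨fun hh => ?_, key γ hγ h⟩
  simpa using key γ⁻¹ (G.inv_mem hγ) _ hh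

/-- `b` fixes `∞` and scales the first column by `b 0 0`, which cancels: only the boundary point `h
• ∞` matters. -/
lemma mul_mem_expandingSet_iff {b : SL(2, ℝ)} (hb : b 1 0 = 0) (ε : ℝ) (h : SL(2, ℝ)) :
    h * b ∈ expandingSet S ε ↔ h ∈ expandingSet S ε := by
  have hb0 : b 0 0 ≠ 0 := by
    intro h0
    have := det_eq_one b
    simp [h0, hb] at this
  have hcol : ∀ h : SL(2, ℝ),
      Real.log (colSq (h * b) 0) = Real.log (b 0 0 ^ 2) + Real.log (colSq h 0) := by
    intro h
    rw [← Real.log_mul (pow_ne_zero 2 hb0) (colSq_pos h 0).ne']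
    simp only [colSq, mul_entry, hb]
    ring_nf
  simp only [expandingSet, mem_ofPred_eq, ← mul_assoc, hcol, add_sub_add_left_eq_sub]

lemma birkhoffSum_flow (hφm : Measurable φ) {M : ℝ} (hφM : ∀ g, |φ g| ≤ M) (h : SL(2, ℝ))
    (n : ℕ) :
    birkhoffSum (· * diagFlow 1) (fun g => ∫ t in (0 : ℝ)..1, φ (g * diagFlow t)) n h =
      ∫ t in (0 : ℝ)..n, φ (h * diagFlow t) := by
  have hint := intervalIntegrable_flow hφm hφM h
  have hiter : ∀ k : ℕ, (· * diagFlow 1)^[k] h = h * diagFlow k := by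
    intro k
    induction k with
    | zero => simp [diagFlow_zero]
    | succ k ih => rw [Function.iterate_succ_apply', ih, mul_assoc, ← diagFlow_add, Nat.cast_succ]
  induction n with
  | zero => simp
  | succ n ih =>
    rw [birkhoffSum_succ, ih, hiter, Nat.cast_succ,
      ← intervalIntegral.integral_add_adjacent_intervals (hint 0 n) (hint n (n + 1))]
    congr 1
    simp_rw [mul_assoc, ← diagFlow_add]
    rw [intervalIntegral.integral_comp_add_left (fun t => φ (h * diagFlow t)), add_zero]

/-- The final time `T` is at least `ε * n` plus a large surplus, while the weight collected up to
`T` is at most `C * n` plus a constant. -/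
lemma exists_intervalIntegral_pos (hφm : Measurable φ) {M : ℝ} (hφM : ∀ g, φ g ≤ M)
    (hφ0 : ∀ g, 0 ≤ φ g) (hφ : ∀ γ ∈ G, ∀ g, φ g ≤ frobSq (γ * g)) {C : ℝ} (hC0 : 0 < C)
    (hC : ∀ s : G, s ∈ S ∨ s⁻¹ ∈ S → 2 * frobSq s ^ 2 * Real.exp (frobSq s ^ 2) ≤ C)
    {ε : ℝ} (hε : 0 < ε) {h : SL(2, ℝ)} (hh : h ∈ expandingSet S ε) :
    ∃ n : ℕ, 0 < ∫ t in (0 : ℝ)..n, (1 - ε / C * φ (h * diagFlow t)) := by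
  have hint := intervalIntegrable_flow hφm (fun g => by rw [abs_of_nonneg (hφ0 g)]; exact hφM g) h
  have hM : 0 ≤ M := (hφ0 1).trans (hφM 1)
  have hbound : ∀ a b : ℝ, |∫ t in a..b, φ (h * diagFlow t)| ≤ M * |b - a| := fun a b =>
    intervalIntegral.norm_integral_le_of_norm_le_const (f := fun t => φ (h * diagFlow t))
      (C := M) fun t _ => by
      rw [Real.norm_of_nonneg (hφ0 _)]
      exact hφM _
  set c := ε / C with hc
  have hc0 : 0 < c := div_pos hε hC0
  -- The surplus pays for the first column of `h`, the stretch between `0` and `logModulus h`, and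
  -- rounding `T` up to an integer.
  obtain ⟨J, hJ⟩ := exists_nat_gt
    (|Real.log (colSq h 0)| + c * (M * |0 - logModulus h|) + c * M)
  obtain ⟨n, g, ⟨l, hln, hlS, rfl⟩, hlt⟩ := hh J
  set T := logModulus ((l.prod : G) * h) with hT
  have h1 := intervalIntegral_le_mul_length hφm hφM hφ0 hφ hC h l hlS
  have h2 := neg_log_colSq_le_logModulus ((l.prod : G) * h)
  have h3 : c * ∫ t in logModulus h..T, φ (h * diagFlow t) ≤ ε * n := by
    have : (l.length : ℝ) ≤ n := by exact_mod_cast hln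
    calc c * ∫ t in logModulus h..T, φ (h * diagFlow t) ≤ c * (C * l.length) := by gcongr
      _ = ε * l.length := by rw [hc]; field_simp
      _ ≤ ε * n := by gcongr
  have hT0 : 0 ≤ T := by
    have : 0 ≤ ε * n := by positivity
    have : 0 ≤ c * (M * |0 - logModulus h|) := by positivity
    have : 0 ≤ c * M := by positivity
    linarith [neg_abs_le (Real.log (colSq h 0)), le_abs_self (Real.log (colSq h 0))]
  refine ⟨⌈T⌉₊, ?_⟩
  rw [intervalIntegral.integral_sub (by simp) ((hint _ _).const_mul c),
    intervalIntegral.integral_const_mul,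
    ← intervalIntegral.integral_add_adjacent_intervals (hint 0 T) (hint T _),
    ← intervalIntegral.integral_add_adjacent_intervals (hint 0 (logModulus h)) (hint _ T)]
  have h4 := (abs_le.1 (hbound 0 (logModulus h))).2
  have h5 := (abs_le.1 (hbound T ⌈T⌉₊)).2
  have h6 : |(⌈T⌉₊ : ℝ) - T| ≤ 1 := by
    rw [abs_le]
    constructor <;> linarith [Nat.le_ceil T, Nat.ceil_lt_add_one hT0]
  have h7 : c * ∫ t in T..⌈T⌉₊, φ (h * diagFlow t) ≤ c * M := by
    gcongr
    exact h5.trans (mul_le_of_le_one_right hM h6)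
  have h8 : c * ∫ t in (0 : ℝ)..logModulus h, φ (h * diagFlow t) ≤
      c * (M * |0 - logModulus h|) := by
    rw [abs_sub_comm]
    gcongr
  have h9 : (∫ _ in (0 : ℝ)..⌈T⌉₊, (1 : ℝ)) = ⌈T⌉₊ := by simp
  rw [h9, mul_add, mul_add]
  linarith [Nat.le_ceil T, neg_abs_le (Real.log (colSq h 0)), le_abs_self (Real.log (colSq h 0))]

end Words

/-! ### Small elements of a discrete group -/

/-- The sum of the absolute values of the entries of a `2 × 2` matrix. -/
def entryNorm (m : Matrix (Fin 2) (Fin 2) ℝ) : ℝ := |m 0 0| + |m 0 1| + (|m 1 0| + |m 1 1|)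

lemma entryNorm_nonneg (m : Matrix (Fin 2) (Fin 2) ℝ) : 0 ≤ entryNorm m := by
  unfold entryNorm
  positivity

lemma entryNorm_add_le (m n : Matrix (Fin 2) (Fin 2) ℝ) :
    entryNorm (m + n) ≤ entryNorm m + entryNorm n := by
  simp only [entryNorm, Matrix.add_apply]
  linarith [abs_add_le (m 0 0) (n 0 0), abs_add_le (m 0 1) (n 0 1), abs_add_le (m 1 0) (n 1 0),
    abs_add_le (m 1 1) (n 1 1)]

lemma entryNorm_sub_le (m n : Matrix (Fin 2) (Fin 2) ℝ) :
    entryNorm (m - n) ≤ entryNorm m + entryNorm n := by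
  have h := entryNorm_add_le m (-n)
  rw [← sub_eq_add_neg] at h
  simpa [entryNorm] using h

lemma entryNorm_mul_le (m n : Matrix (Fin 2) (Fin 2) ℝ) :
    entryNorm (m * n) ≤ entryNorm m * entryNorm n := by
  have h : ∀ i j, |(m * n) i j| ≤ |m i 0| * |n 0 j| + |m i 1| * |n 1 j| := by
    intro i j
    rw [Matrix.mul_apply, Fin.sum_univ_two, ← abs_mul, ← abs_mul]
    exact abs_add_le _ _
  have h00 := h 0 0
  have h01 := h 0 1
  have h10 := h 1 0
  have h11 := h 1 1
  have p : ∀ i j k l, 0 ≤ |m i j| * |n k l| := fun i j k l => by positivity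
  simp only [entryNorm]
  nlinarith [p 0 0 1 0, p 0 0 1 1, p 0 1 0 0, p 0 1 0 1, p 1 0 1 0, p 1 0 1 1, p 1 1 0 0,
    p 1 1 0 1]

lemma entryNorm_inv (m : SL(2, ℝ)) : entryNorm (m⁻¹ : SL(2, ℝ)) = entryNorm m := by
  rw [Matrix.SpecialLinearGroup.SL2_inv_expl]
  simp [entryNorm]
  ring

lemma entryNorm_sq_le (m : SL(2, ℝ)) : entryNorm m ^ 2 ≤ 4 * frobSq m := by
  simp only [entryNorm, frobSq, colSq, ← sq_abs (m 0 0), ← sq_abs (m 0 1), ← sq_abs (m 1 0),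
    ← sq_abs (m 1 1)]
  generalize |m 0 0| = a
  generalize |m 0 1| = b
  generalize |m 1 0| = c
  generalize |m 1 1| = d
  nlinarith [sq_nonneg (a - b), sq_nonneg (a - c), sq_nonneg (a - d), sq_nonneg (b - c),
    sq_nonneg (b - d), sq_nonneg (c - d)]

lemma abs_apply_le_entryNorm (m : Matrix (Fin 2) (Fin 2) ℝ) (i j : Fin 2) :
    |m i j| ≤ entryNorm m := by
  have p : ∀ i j, 0 ≤ |m i j| := fun i j => abs_nonneg _
  unfold entryNorm
  fin_cases i <;> fin_cases j <;> simp <;> linarith [p 0 0, p 0 1, p 1 0, p 1 1]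

lemma continuous_entryNorm_sub_one :
    Continuous fun m : SL(2, ℝ) => entryNorm ((m : Matrix (Fin 2) (Fin 2) ℝ) - 1) := by
  have h : ∀ i j, Continuous fun m : SL(2, ℝ) => |((m : Matrix (Fin 2) (Fin 2) ℝ) - 1) i j| := by
    intro i j
    simp only [Matrix.sub_apply]
    exact ((continuous_entry i j).sub continuous_const).abs
  exact ((h 0 0).add (h 0 1)).add ((h 1 0).add (h 1 1))

lemma exists_pos_forall_le_entryNorm (G : Subgroup SL(2, ℝ)) [DiscreteTopology G] :
    ∃ c > 0, ∀ γ ∈ G, γ ≠ 1 → c ≤ entryNorm ((γ : Matrix (Fin 2) (Fin 2) ℝ) - 1) := by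
  by_contra! hcon
  choose γ hγG hγ1 hγ using fun n : ℕ => hcon (1 / (n + 1)) Nat.one_div_pos_of_nat
  have hlim : ∀ i j, Tendsto (fun n => γ n i j) atTop (𝓝 ((1 : SL(2, ℝ)) i j)) := by
    intro i j
    rw [tendsto_iff_norm_sub_tendsto_zero]
    refine squeeze_zero (fun n => norm_nonneg _) (fun n => ?_) tendsto_one_div_add_atTop_nhds_zero_nat
    refine le_trans ?_ (hγ n).le
    have := abs_apply_le_entryNorm ((γ n : Matrix (Fin 2) (Fin 2) ℝ) - 1) i j
    simpa using this
  have h1 : Tendsto γ atTop (𝓝 1) := by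
    refine Matrix.SpecialLinearGroup.isClosedEmbedding_val.isEmbedding.tendsto_nhds_iff.2 ?_
    exact tendsto_pi_nhds.2 fun i => tendsto_pi_nhds.2 fun j => hlim i j
  have h2 : Tendsto (fun n => (⟨γ n, hγG n⟩ : G)) atTop (𝓝 1) := tendsto_subtype_rng.2 h1
  rw [nhds_discrete, tendsto_pure] at h2
  obtain ⟨n, hn⟩ := h2.exists
  exact hγ1 n (congrArg Subtype.val hn)

/-- The equations make `(x, y, z)` parallel to `(b, c, e)`; the functional reads off the coordinate
where `(b, c, e)` is largest. -/
lemma exists_dominating_coordinate {b c e : ℝ} (h : ¬(b = 0 ∧ c = 0 ∧ e = 0)) :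
    ∃ α β γ : ℝ, |α| ≤ 1 ∧ |β| ≤ 1 ∧ |γ| ≤ 1 ∧ ∀ x y z : ℝ, x * c = y * b → b * z = x * e →
      c * z = y * e → |x| ≤ |α * x + β * y + γ * z| ∧ |y| ≤ |α * x + β * y + γ * z| ∧
        |z| ≤ |α * x + β * y + γ * z| := by
  have key : ∀ {u v x y : ℝ}, u ≠ 0 → |v| ≤ |u| → y * u = x * v → |y| ≤ |x| := by
    intro u v x y hu huv hxy
    have h1 : |y| * |u| = |x| * |v| := by rw [← abs_mul, ← abs_mul, hxy]
    have h2 : |y| * |u| ≤ |x| * |u| := h1 ▸ mul_le_mul_of_nonneg_left huv (abs_nonneg x)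
    exact le_of_mul_le_mul_right h2 (abs_pos.2 hu)
  by_cases hb : |c| ≤ |b| ∧ |e| ≤ |b|
  · have hb0 : b ≠ 0 := by
      rintro rfl
      simp at hb
      exact h ⟨rfl, hb⟩
    refine ⟨1, 0, 0, by simp, by simp, by simp, fun x y z h1 h2 h3 => ?_⟩
    simp only [one_mul, zero_mul, add_zero]
    exact ⟨le_rfl, key hb0 hb.1 h1.symm, key hb0 hb.2 (by linarith)⟩
  by_cases hc : |b| ≤ |c| ∧ |e| ≤ |c|
  · have hc0 : c ≠ 0 := by
      rintro rfl
      simp at hc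
      exact h ⟨hc.1, rfl, hc.2⟩
    refine ⟨0, 1, 0, by simp, by simp, by simp, fun x y z h1 h2 h3 => ?_⟩
    simp only [one_mul, zero_mul, add_zero, zero_add]
    exact ⟨key hc0 hc.1 h1, le_rfl, key hc0 hc.2 (by linarith)⟩
  · have he : |b| ≤ |e| ∧ |c| ≤ |e| := by
      rw [not_and_or, not_le, not_le] at hb hc
      constructor <;> rcases hb with hb | hb <;> rcases hc with hc | hc <;> linarith
    have he0 : e ≠ 0 := by
      rintro rfl
      simp at he
      exact h ⟨he.1, he.2, rfl⟩
    refine ⟨0, 0, 1, by simp, by simp, by simp, fun x y z h1 h2 h3 => ?_⟩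
    simp only [one_mul, zero_mul, zero_add]
    exact ⟨key he0 he.1 (by linarith), key he0 he.2 (by linarith), le_rfl⟩

lemma abs_le_of_mem_nearOne {m : SL(2, ℝ)}
    (hm : entryNorm ((m : Matrix (Fin 2) (Fin 2) ℝ) - 1) ≤ 1 / 36) :
    |m 0 1| ≤ 1 / 36 ∧ |m 1 0| ≤ 1 / 36 ∧ |m 0 0 - 1| ≤ 1 / 36 ∧ |m 1 1 - 1| ≤ 1 / 36 := by
  have h := fun i j => (abs_apply_le_entryNorm ((m : Matrix (Fin 2) (Fin 2) ℝ) - 1) i j).trans hm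
  have h00 := h 0 0
  have h01 := h 0 1
  have h10 := h 1 0
  have h11 := h 1 1
  simp at h00 h01 h10 h11
  simp only [one_div]
  exact ⟨h01, h10, h00, h11⟩

lemma entryNorm_le_three {m : SL(2, ℝ)}
    (hm : entryNorm ((m : Matrix (Fin 2) (Fin 2) ℝ) - 1) ≤ 1 / 36) : entryNorm m ≤ 3 := by
  have h := entryNorm_add_le ((m : Matrix (Fin 2) (Fin 2) ℝ) - 1) 1
  rw [sub_add_cancel] at h
  have h1 : entryNorm 1 = 2 := by
    simp [entryNorm]
    norm_num
  linarith

/-- On the centralizer of a non-central element, near the identity, one coordinate controls the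
distance. -/
lemma exists_coordinate_of_commute {m₀ : SL(2, ℝ)}
    (h₀ : ¬(m₀ 0 1 = 0 ∧ m₀ 1 0 = 0 ∧ m₀ 0 0 - m₀ 1 1 = 0)) :
    ∃ f : SL(2, ℝ) → ℝ,
      (∀ m : SL(2, ℝ), entryNorm ((m : Matrix (Fin 2) (Fin 2) ℝ) - 1) ≤ 1 / 36 → |f m| ≤ 1) ∧
      ∀ m m' : SL(2, ℝ), entryNorm ((m : Matrix (Fin 2) (Fin 2) ℝ) - 1) ≤ 1 / 36 →
        entryNorm ((m' : Matrix (Fin 2) (Fin 2) ℝ) - 1) ≤ 1 / 36 →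
        m * m₀ = m₀ * m → m' * m₀ = m₀ * m' →
        entryNorm ((m : Matrix (Fin 2) (Fin 2) ℝ) - m') ≤ 4 * |f m - f m'| := by
  obtain ⟨α, β, γ, hα, hβ, hγ, h⟩ := exists_dominating_coordinate h₀
  refine ⟨fun m => α * m 0 1 + β * m 1 0 + γ * (m 0 0 - m 1 1), fun m hm => ?_,
    fun m m' hm hm' hc hc' => ?_⟩
  · obtain ⟨h1, h2, h3, h4⟩ := abs_le_of_mem_nearOne hm
    have h5 : |m 0 0 - m 1 1| ≤ 2 / 36 := by
      rw [abs_le] at *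
      constructor <;> linarith
    calc |α * m 0 1 + β * m 1 0 + γ * (m 0 0 - m 1 1)|
        ≤ |α| * |m 0 1| + |β| * |m 1 0| + |γ| * |m 0 0 - m 1 1| := by
          rw [← abs_mul, ← abs_mul, ← abs_mul]
          exact abs_add_three _ _ _
      _ ≤ 1 * (1 / 36) + 1 * (1 / 36) + 1 * (2 / 36) := by gcongr
      _ ≤ 1 := by norm_num
  -- Commuting with `m₀` forces the traceless part to be parallel to that of `m₀`.
  · have comm : ∀ m : SL(2, ℝ), m * m₀ = m₀ * m → m 0 1 * m₀ 1 0 = m 1 0 * m₀ 0 1 ∧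
        m₀ 0 1 * (m 0 0 - m 1 1) = m 0 1 * (m₀ 0 0 - m₀ 1 1) ∧
        m₀ 1 0 * (m 0 0 - m 1 1) = m 1 0 * (m₀ 0 0 - m₀ 1 1) := by
      intro m hc
      have h00 := congrArg (fun k : SL(2, ℝ) => k 0 0) hc
      have h01 := congrArg (fun k : SL(2, ℝ) => k 0 1) hc
      have h10 := congrArg (fun k : SL(2, ℝ) => k 1 0) hc
      simp only [mul_entry] at h00 h01 h10
      refine ⟨by linarith, by linarith, by linarith⟩
    obtain ⟨c1, c2, c3⟩ := comm m hc
    obtain ⟨c1', c2', c3'⟩ := comm m' hc'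
    obtain ⟨k1, k2, k3⟩ := h (m 0 1 - m' 0 1) (m 1 0 - m' 1 0)
      ((m 0 0 - m 1 1) - (m' 0 0 - m' 1 1)) (by linarith) (by linarith) (by linarith)
    have hΔ : α * m 0 1 + β * m 1 0 + γ * (m 0 0 - m 1 1) -
        (α * m' 0 1 + β * m' 1 0 + γ * (m' 0 0 - m' 1 1)) =
        α * (m 0 1 - m' 0 1) + β * (m 1 0 - m' 1 0) +
          γ * ((m 0 0 - m 1 1) - (m' 0 0 - m' 1 1)) := by ring
    simp only [hΔ]
    set Δ := |α * (m 0 1 - m' 0 1) + β * (m 1 0 - m' 1 0) +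
          γ * ((m 0 0 - m 1 1) - (m' 0 0 - m' 1 1))|
    obtain ⟨h1, h2, h3, h4⟩ := abs_le_of_mem_nearOne hm
    obtain ⟨h1', h2', h3', h4'⟩ := abs_le_of_mem_nearOne hm'
    have d := det_eq_one m
    have d' := det_eq_one m'
    have hΔ0 : 0 ≤ Δ := abs_nonneg _
    -- The traceless part determines the trace through `tr² = (m 0 0 - m 1 1)² + 4 * m 0 1 * m 1 0 +
    -- 4`; near the identity the two traces add up to at least `3`, so one may divide.
    have htr : |(m 0 0 + m 1 1) - (m' 0 0 + m' 1 1)| ≤ Δ := by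
      have e1 : ((m 0 0 + m 1 1) - (m' 0 0 + m' 1 1)) * ((m 0 0 + m 1 1) + (m' 0 0 + m' 1 1)) =
          ((m 0 0 - m 1 1) - (m' 0 0 - m' 1 1)) * ((m 0 0 - m 1 1) + (m' 0 0 - m' 1 1)) +
          4 * ((m 0 1 - m' 0 1) * m 1 0) + 4 * (m' 0 1 * (m 1 0 - m' 1 0)) := by
        linear_combination 4 * d - 4 * d'
      have e2 : 3 ≤ |(m 0 0 + m 1 1) + (m' 0 0 + m' 1 1)| := by
        rw [abs_le] at *
        exact le_trans (by linarith) (le_abs_self _)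
      have e3 : |(m 0 0 - m 1 1) + (m' 0 0 - m' 1 1)| ≤ 4 / 36 := by
        rw [abs_le] at *
        constructor <;> linarith
      have e4 := congrArg abs e1
      rw [abs_mul] at e4
      have e5 : |((m 0 0 - m 1 1) - (m' 0 0 - m' 1 1)) * ((m 0 0 - m 1 1) + (m' 0 0 - m' 1 1)) +
          4 * ((m 0 1 - m' 0 1) * m 1 0) + 4 * (m' 0 1 * (m 1 0 - m' 1 0))| ≤
          Δ * (4 / 36) + 4 * (Δ * (1 / 36)) + 4 * (1 / 36 * Δ) := by
        refine (abs_add_three _ _ _).trans ?_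
        rw [abs_mul 4, abs_mul 4, abs_mul, abs_mul, abs_mul, abs_of_pos (four_pos : (0 : ℝ) < 4)]
        gcongr
      have e6 : |(m 0 0 + m 1 1) - (m' 0 0 + m' 1 1)| * 3 ≤ Δ := by
        refine (mul_le_mul_of_nonneg_left e2 (abs_nonneg _)).trans ?_
        linarith
      linarith [abs_nonneg ((m 0 0 + m 1 1) - (m' 0 0 + m' 1 1))]
    have g0 : |m 0 0 - m' 0 0| ≤ Δ := by
      rw [abs_le] at *
      constructor <;> linarith
    have g1 : |m 1 1 - m' 1 1| ≤ Δ := by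
      rw [abs_le] at *
      constructor <;> linarith
    simp only [entryNorm, Matrix.sub_apply]
    linarith

/-- Counting separated points of a bounded interval. -/
lemma encard_le_of_separated {X : Type*} {T : Set X} {f : X → ℝ} {η : ℝ} (hη : 0 < η)
    (hf : ∀ x ∈ T, |f x| ≤ 1) (hsep : ∀ x ∈ T, ∀ y ∈ T, x ≠ y → η ≤ |f x - f y|) :
    T.encard ≤ (2 * ⌈1 / η⌉₊ + 1 : ℕ) := by
  set K := ⌈1 / η⌉₊
  have hK : 1 / η ≤ K := Nat.le_ceil _
  have hmaps : ∀ x ∈ T, ⌊f x / η⌋ ∈ (Finset.Icc (-(K : ℤ)) K : Set ℤ) := by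
    intro x hx
    have h1 := abs_le.1 (hf x hx)
    have h2 : f x / η ≤ 1 / η := by gcongr; exact h1.2
    have h3 : -(1 / η) ≤ f x / η := by rw [← neg_div]; gcongr; exact h1.1
    rw [Finset.coe_Icc, mem_Icc]
    constructor
    · rw [Int.le_floor]
      push_cast
      linarith
    · have : (⌊f x / η⌋ : ℝ) ≤ K := (Int.floor_le _).trans (h2.trans hK)
      exact_mod_cast this
  have hinj : InjOn (fun x => ⌊f x / η⌋) T := by
    intro x hx y hy hxy
    by_contra hne
    have h1 := hsep x hx y hy hne
    have h2 := Int.abs_sub_lt_one_of_floor_eq_floor hxy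
    rw [← sub_div, abs_div, abs_of_pos hη, div_lt_one hη] at h2
    linarith
  have hsub : (fun x => ⌊f x / η⌋) '' T ⊆ (Finset.Icc (-(K : ℤ)) K : Set ℤ) := by
    rintro _ ⟨x, hx, rfl⟩
    exact hmaps x hx
  rw [← hinj.encard_image]
  refine (encard_le_encard hsub).trans ?_
  rw [encard_coe_eq_coe_finsetCard, Int.card_Icc]
  norm_cast
  omega

/-- A discrete group has, near the identity and after conjugation by `h`, at most about
`‖h‖ ^ 2` elements. -/
lemma exists_encard_conj_le (G : Subgroup SL(2, ℝ)) [DiscreteTopology G] :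
    ∃ c > 0, ∀ h : SL(2, ℝ),
      {m : SL(2, ℝ) | h * m * h⁻¹ ∈ G ∧
        entryNorm ((m : Matrix (Fin 2) (Fin 2) ℝ) - 1) ≤ 1 / 36}.encard ≤
      (2 * ⌈c * frobSq h⌉₊ + 1 : ℕ) := by
  obtain ⟨c, hc0, hc⟩ := exists_pos_forall_le_entryNorm G
  refine ⟨48 / c, by positivity, fun h => ?_⟩
  set e : SL(2, ℝ) → ℝ := fun m => entryNorm ((m : Matrix (Fin 2) (Fin 2) ℝ) - 1) with he
  set T := {m : SL(2, ℝ) | h * m * h⁻¹ ∈ G ∧ e m ≤ 1 / 36}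
  have hfrob : 0 < frobSq h := two_pos.trans_le (two_le_frobSq h)
  set η := c / (4 * frobSq h) with hη
  have hη0 : 0 < η := by positivity
  -- Conjugation by `h` shrinks the gap `c` around the identity by at most the factor `entryNorm h ^
  -- 2`.
  have hlow : ∀ m, h * m * h⁻¹ ∈ G → m ≠ 1 → η ≤ e m := by
    intro m hm hm1
    have h1 := hc _ hm (by simpa [mul_inv_eq_one] using hm1)
    have h2 : ((h * m * h⁻¹ : SL(2, ℝ)) : Matrix (Fin 2) (Fin 2) ℝ) - 1 =
        (h : Matrix (Fin 2) (Fin 2) ℝ) * ((m : Matrix (Fin 2) (Fin 2) ℝ) - 1) *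
          (h⁻¹ : SL(2, ℝ)) := by
      have h3 : (h : Matrix (Fin 2) (Fin 2) ℝ) * (h⁻¹ : SL(2, ℝ)) = 1 := by
        rw [← Matrix.SpecialLinearGroup.coe_mul, mul_inv_cancel, Matrix.SpecialLinearGroup.coe_one]
      rw [Matrix.SpecialLinearGroup.coe_mul, Matrix.SpecialLinearGroup.coe_mul, mul_sub, sub_mul,
        mul_one, h3]
    rw [h2] at h1
    have h4 := entryNorm_mul_le ((h : Matrix (Fin 2) (Fin 2) ℝ) *
      ((m : Matrix (Fin 2) (Fin 2) ℝ) - 1)) (h⁻¹ : SL(2, ℝ))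
    have h5 := entryNorm_mul_le (h : Matrix (Fin 2) (Fin 2) ℝ)
      ((m : Matrix (Fin 2) (Fin 2) ℝ) - 1)
    rw [entryNorm_inv] at h4
    have h6 := entryNorm_sq_le h
    have h7 := entryNorm_nonneg (h : Matrix (Fin 2) (Fin 2) ℝ)
    have h8 : 0 ≤ e m := entryNorm_nonneg _
    rw [hη, div_le_iff₀ (by positivity)]
    calc c ≤ entryNorm h * e m * entryNorm h := h1.trans (h4.trans (by gcongr))
      _ = entryNorm h ^ 2 * e m := by ring
      _ ≤ 4 * frobSq h * e m := by gcongr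
      _ = e m * (4 * frobSq h) := mul_comm _ _
  have hmulG : ∀ m n, h * m * h⁻¹ ∈ G → h * n * h⁻¹ ∈ G → h * (m * n) * h⁻¹ ∈ G := by
    intro m n hm hn
    have := G.mul_mem hm hn
    simpa [mul_assoc] using this
  have hinvG : ∀ m, h * m * h⁻¹ ∈ G → h * m⁻¹ * h⁻¹ ∈ G := by
    intro m hm
    have := G.inv_mem hm
    simpa [mul_assoc] using this
  by_cases hT1 : T ⊆ {1}
  · refine (encard_le_encard hT1).trans ?_
    rw [encard_singleton]
    norm_cast
    omega
  obtain ⟨m₁, hm₁T, hm₁⟩ := not_subset.1 hT1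
  set s := sInf (e '' (T \ {1})) with hs
  have hbdd : BddBelow (e '' (T \ {1})) := ⟨0, by rintro _ ⟨m, -, rfl⟩; exact entryNorm_nonneg _⟩
  have hne : (e '' (T \ {1})).Nonempty := ⟨e m₁, m₁, ⟨hm₁T, hm₁⟩, rfl⟩
  have hs0 : 0 < s := by
    refine hη0.trans_le (le_csInf hne ?_)
    rintro _ ⟨m, hm, rfl⟩
    exact hlow m hm.1.1 hm.2
  -- Minimal up to a factor `2`, so the infimum need not be attained.
  obtain ⟨_, ⟨m₀, hm₀, rfl⟩, hm₀s⟩ := exists_lt_of_csInf_lt hne (show s < 2 * s by linarith)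
  -- Commutators of small elements are smaller: `e k ≤ 18 * e m * e m₀`, and the radius `1 / 36`
  -- makes this at most `e m₀ / 2 < s`, which forces `k = 1`.
  have hcomm : ∀ m ∈ T, m * m₀ = m₀ * m := by
    intro m hm
    set k := m * m₀ * m⁻¹ * m₀⁻¹ with hk
    have hkG : h * k * h⁻¹ ∈ G :=
      hmulG _ _ (hmulG _ _ (hmulG _ _ hm.1 hm₀.1.1) (hinvG _ hm.1)) (hinvG _ hm₀.1.1)
    have h1 : (k : Matrix (Fin 2) (Fin 2) ℝ) - 1 =
        (((m : Matrix (Fin 2) (Fin 2) ℝ) - 1) * ((m₀ : Matrix (Fin 2) (Fin 2) ℝ) - 1) -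
        ((m₀ : Matrix (Fin 2) (Fin 2) ℝ) - 1) * ((m : Matrix (Fin 2) (Fin 2) ℝ) - 1)) *
          (m⁻¹ : SL(2, ℝ)) * (m₀⁻¹ : SL(2, ℝ)) := by
      have h2 : (m₀ : Matrix (Fin 2) (Fin 2) ℝ) * m * (m⁻¹ : SL(2, ℝ)) * (m₀⁻¹ : SL(2, ℝ)) = 1 := by
        rw [← Matrix.SpecialLinearGroup.coe_mul, ← Matrix.SpecialLinearGroup.coe_mul,
          ← Matrix.SpecialLinearGroup.coe_mul, mul_inv_cancel_right, mul_inv_cancel,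
          Matrix.SpecialLinearGroup.coe_one]
      rw [← h2, hk, Matrix.SpecialLinearGroup.coe_mul, Matrix.SpecialLinearGroup.coe_mul,
        Matrix.SpecialLinearGroup.coe_mul, h2]
      rw [show ((m : Matrix (Fin 2) (Fin 2) ℝ) - 1) * ((m₀ : Matrix (Fin 2) (Fin 2) ℝ) - 1) -
        ((m₀ : Matrix (Fin 2) (Fin 2) ℝ) - 1) * ((m : Matrix (Fin 2) (Fin 2) ℝ) - 1) =
        (m : Matrix (Fin 2) (Fin 2) ℝ) * m₀ - (m₀ : Matrix (Fin 2) (Fin 2) ℝ) * m by noncomm_ring,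
        sub_mul, sub_mul, h2]
    have e0 : ∀ m : SL(2, ℝ), 0 ≤ e m := fun m => entryNorm_nonneg _
    have h3 : e k ≤ (e m * e m₀ + e m₀ * e m) * 3 * 3 := by
      change entryNorm ((k : Matrix (Fin 2) (Fin 2) ℝ) - 1) ≤ _
      rw [h1]
      refine (entryNorm_mul_le _ _).trans ?_
      rw [entryNorm_inv]
      have a1 := entryNorm_le_three hm.2
      have a2 := entryNorm_le_three hm₀.1.2
      have := e0 m
      have := e0 m₀
      refine mul_le_mul ?_ a2 (entryNorm_nonneg _) (by positivity)
      refine (entryNorm_mul_le _ _).trans ?_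
      rw [entryNorm_inv]
      refine mul_le_mul ?_ a1 (entryNorm_nonneg _) (by positivity)
      exact (entryNorm_sub_le _ _).trans (add_le_add (entryNorm_mul_le _ _) (entryNorm_mul_le _ _))
    have hme : e m ≤ 1 / 36 := hm.2
    have hm₀e : e m₀ ≤ 1 / 36 := hm₀.1.2
    have h4 : e k ≤ e m₀ / 2 := by
      have := mul_le_mul_of_nonneg_right hme (e0 m₀)
      nlinarith
    have hk1 : k = 1 := by
      by_contra hk1
      have hkT : k ∈ T := ⟨hkG, by linarith [e0 m₀]⟩
      have : s ≤ e k := csInf_le hbdd ⟨k, ⟨hkT, hk1⟩, rfl⟩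
      linarith
    rw [hk, mul_inv_eq_one, mul_inv_eq_iff_eq_mul] at hk1
    exact hk1
  have hm₀ns : ¬(m₀ 0 1 = 0 ∧ m₀ 1 0 = 0 ∧ m₀ 0 0 - m₀ 1 1 = 0) := by
    rintro ⟨h1, h2, h3⟩
    have hd := det_eq_one m₀
    obtain ⟨-, -, h4, -⟩ := abs_le_of_mem_nearOne hm₀.1.2
    have h5 : m₀ 1 1 = m₀ 0 0 := by linarith
    rw [h1, zero_mul, sub_zero, h5] at hd
    have h6 : m₀ 0 0 = 1 := by
      have := abs_le.1 h4
      have h7 : (m₀ 0 0 - 1) * (m₀ 0 0 + 1) = 0 := by linarith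
      rcases mul_eq_zero.1 h7 with h8 | h8 <;> linarith
    refine hm₀.2 ?_
    ext i j
    fin_cases i <;> fin_cases j <;> simp [h1, h2, h5, h6]
  obtain ⟨f, hf1, hf⟩ := exists_coordinate_of_commute hm₀ns
  -- All of `T` lies in the one-dimensional centralizer of `m₀`, and `m * m'⁻¹` obeys the gap
  -- `hlow`; so the count is linear in `1 / η`.
  have hsep : ∀ m ∈ T, ∀ m' ∈ T, m ≠ m' → η / 12 ≤ |f m - f m'| := by
    intro m hm m' hm' hne
    have h1 := hf m m' hm.2 hm'.2 (hcomm m hm) (hcomm m' hm')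
    have h2 := hlow (m * m'⁻¹) (hmulG _ _ hm.1 (hinvG _ hm'.1)) (by simpa [mul_inv_eq_one] using hne)
    have h3 : ((m * m'⁻¹ : SL(2, ℝ)) : Matrix (Fin 2) (Fin 2) ℝ) - 1 =
        ((m : Matrix (Fin 2) (Fin 2) ℝ) - m') * (m'⁻¹ : SL(2, ℝ)) := by
      rw [sub_mul, ← Matrix.SpecialLinearGroup.coe_mul, ← Matrix.SpecialLinearGroup.coe_mul,
        mul_inv_cancel, Matrix.SpecialLinearGroup.coe_one]
    have h4 : e (m * m'⁻¹) ≤ 4 * |f m - f m'| * 3 := by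
      change entryNorm (((m * m'⁻¹ : SL(2, ℝ)) : Matrix (Fin 2) (Fin 2) ℝ) - 1) ≤ _
      rw [h3]
      refine (entryNorm_mul_le _ _).trans ?_
      rw [entryNorm_inv]
      exact mul_le_mul h1 (entryNorm_le_three hm'.2) (entryNorm_nonneg _) (by positivity)
    linarith
  have hfin := encard_le_of_separated (by positivity) (fun m hm => hf1 m hm.2) hsep
  rwa [show 1 / (η / 12) = 48 / c * frobSq h by rw [hη]; field_simp; norm_num] at hfin

/-! ### Distance to an orbit -/

lemma frobSq_eq_two_mul_cosh_dist (g : SL(2, ℝ)) :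
    frobSq g = 2 * Real.cosh (dist (g • UpperHalfPlane.I) UpperHalfPlane.I) := by
  have hd := det_eq_one g
  have hpos : 0 < g 1 0 ^ 2 + g 1 1 ^ 2 := by
    rcases eq_or_ne (g 1 0) 0 with h | h
    · have : g 1 1 ≠ 0 := by
        intro h1
        simp [h, h1] at hd
      positivity
    · positivity
  have hz : ((g • UpperHalfPlane.I : ℍ) : ℂ) =
      ⟨(g 0 0 * g 1 0 + g 0 1 * g 1 1) / (g 1 0 ^ 2 + g 1 1 ^ 2),
        1 / (g 1 0 ^ 2 + g 1 1 ^ 2)⟩ := by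
    rw [UpperHalfPlane.coe_specialLinearGroup_apply, div_eq_iff]
    · apply Complex.ext <;> simp <;> field_simp
      · linear_combination (-(g 1 0)) * hd
      · linear_combination (g 1 1) * hd
    · intro h
      have h1 := congrArg Complex.re h
      have h2 := congrArg Complex.im h
      simp at h1 h2
      simp [h1, h2] at hpos
  have him : (g • UpperHalfPlane.I : ℍ).im = 1 / (g 1 0 ^ 2 + g 1 1 ^ 2) := by
    rw [← UpperHalfPlane.coe_im, hz]
  rw [UpperHalfPlane.cosh_dist, Complex.dist_eq, ← Complex.normSq_eq_norm_sq, hz, him,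
    Complex.normSq_apply]
  simp only [frobSq, colSq, UpperHalfPlane.coe_I, Complex.sub_re, Complex.sub_im, Complex.I_re,
    Complex.I_im, UpperHalfPlane.I_im]
  field_simp
  linear_combination (g 0 0 * g 1 1 - g 0 1 * g 1 0 + 1) * hd

/-- The exponential of the distance from `g • i` to the orbit `G • i`. -/
noncomputable def cuspWeight (G : Subgroup SL(2, ℝ)) (g : SL(2, ℝ)) : ℝ :=
  Real.exp (Metric.infDist (g • UpperHalfPlane.I) (MulAction.orbit G UpperHalfPlane.I))

section CuspWeight

variable {G : Subgroup SL(2, ℝ)}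

lemma infDist_orbit_smul {γ : SL(2, ℝ)} (hγ : γ ∈ G) (z w : ℍ) :
    Metric.infDist (γ • z) (MulAction.orbit G w) = Metric.infDist z (MulAction.orbit G w) := by
  have h : (fun z : ℍ => γ • z) '' MulAction.orbit G w = MulAction.orbit G w :=
    MulAction.smul_orbit (⟨γ, hγ⟩ : G) w
  conv_lhs => rw [← h]
  exact Metric.infDist_image (isometry_smul ℍ γ)

lemma cuspWeight_mul {γ : SL(2, ℝ)} (hγ : γ ∈ G) (g : SL(2, ℝ)) :
    cuspWeight G (γ * g) = cuspWeight G g := by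
  rw [cuspWeight, mul_smul, infDist_orbit_smul hγ, cuspWeight]

lemma continuous_cuspWeight : Continuous (cuspWeight G) := by
  have : Continuous fun g : SL(2, ℝ) => g • UpperHalfPlane.I := by fun_prop
  exact Real.continuous_exp.comp ((Metric.continuous_infDist_pt _).comp this)

lemma cuspWeight_le_frobSq {γ : SL(2, ℝ)} (hγ : γ ∈ G) (g : SL(2, ℝ)) :
    cuspWeight G g ≤ frobSq (γ * g) := by
  rw [← cuspWeight_mul hγ, frobSq_eq_two_mul_cosh_dist, Real.cosh_eq]
  have h1 : Metric.infDist ((γ * g) • UpperHalfPlane.I) (MulAction.orbit G UpperHalfPlane.I) ≤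
      dist ((γ * g) • UpperHalfPlane.I) UpperHalfPlane.I :=
    Metric.infDist_le_dist_of_mem (MulAction.mem_orbit_self _)
  have h2 := Real.exp_le_exp.2 h1
  have h3 := Real.exp_pos (-dist ((γ * g) • UpperHalfPlane.I) UpperHalfPlane.I)
  unfold cuspWeight
  linarith

/-- If the distance to the orbit stayed below `r`, a closed ball would map onto the quotient;
connectedness of `ℍ` then gives the exact value. -/
lemma exists_infDist_orbit_eq (hnc : ¬ CompactSpace (MulAction.orbitRel.Quotient G ℍ)) {r : ℝ}
    (hr : 0 ≤ r) : ∃ z : ℍ, Metric.infDist z (MulAction.orbit G UpperHalfPlane.I) = r := by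
  have hne : (MulAction.orbit G UpperHalfPlane.I).Nonempty := ⟨_, MulAction.mem_orbit_self _⟩
  suffices h : ∃ z : ℍ, r ≤ Metric.infDist z (MulAction.orbit G UpperHalfPlane.I) by
    refine mem_range_of_exists_le_of_exists_ge (Metric.continuous_infDist_pt _)
      ⟨UpperHalfPlane.I, ?_⟩ h
    rw [Metric.infDist_zero_of_mem (MulAction.mem_orbit_self _)]
    exact hr
  by_contra! hcon
  refine hnc ⟨?_⟩
  have h1 : (Quotient.mk'' : ℍ → MulAction.orbitRel.Quotient G ℍ) ''
      Metric.closedBall UpperHalfPlane.I r = univ := by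
    refine eq_univ_of_forall fun q => ?_
    induction q using Quotient.inductionOn' with
    | h z =>
      obtain ⟨_, ⟨γ, rfl⟩, hγ⟩ := (Metric.infDist_lt_iff hne).1 (hcon z)
      refine ⟨(γ⁻¹ : SL(2, ℝ)) • z, ?_, ?_⟩
      · have h2 := dist_smul (γ : SL(2, ℝ)) ((γ⁻¹ : SL(2, ℝ)) • z) UpperHalfPlane.I
        rw [smul_inv_smul] at h2
        exact (h2.symm.trans_lt hγ).le
      · exact Quotient.sound' ⟨γ⁻¹, rfl⟩
  rw [← h1]
  exact (isCompact_closedBall _ _).image continuous_quotient_mk'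

/-- A translation by `G` makes `i` an almost nearest orbit point, so the norm of `h` is controlled
by `r`. -/
lemma exists_infDist_eq_frobSq_le (hnc : ¬ CompactSpace (MulAction.orbitRel.Quotient G ℍ)) {r : ℝ}
    (hr : 0 ≤ r) : ∃ h : SL(2, ℝ),
      Metric.infDist (h • UpperHalfPlane.I) (MulAction.orbit G UpperHalfPlane.I) = r ∧
      frobSq h ≤ 2 * Real.exp (r + 1) := by
  have hne : (MulAction.orbit G UpperHalfPlane.I).Nonempty := ⟨_, MulAction.mem_orbit_self _⟩
  obtain ⟨z, hz⟩ := exists_infDist_orbit_eq hnc hr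
  obtain ⟨_, ⟨γ, rfl⟩, hγ⟩ := (Metric.infDist_lt_iff hne).1 (hz.trans_lt (lt_add_one r))
  obtain ⟨h, hh⟩ := MulAction.exists_smul_eq SL(2, ℝ) UpperHalfPlane.I
    ((γ⁻¹ : SL(2, ℝ)) • z)
  refine ⟨h, by rw [hh, infDist_orbit_smul (G.inv_mem γ.2), hz], ?_⟩
  have h2 := dist_smul (γ : SL(2, ℝ)) ((γ⁻¹ : SL(2, ℝ)) • z) UpperHalfPlane.I
  rw [smul_inv_smul] at h2
  have h3 : dist (h • UpperHalfPlane.I) UpperHalfPlane.I ≤ r + 1 := by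
    rw [hh, ← h2]
    exact hγ.le
  rw [frobSq_eq_two_mul_cosh_dist, Real.cosh_eq]
  have h4 := Real.exp_le_exp.2 h3
  have h5 : 0 ≤ dist (h • UpperHalfPlane.I) UpperHalfPlane.I := dist_nonneg
  have h6 : Real.exp (-dist (h • UpperHalfPlane.I) UpperHalfPlane.I) ≤ Real.exp (r + 1) :=
    Real.exp_le_exp.2 (by linarith)
  linarith

/-- The cusps carry infinitely much weight. -/
lemma IsCovolumeMeasure.exists_lt_integral_min_cuspWeight [DiscreteTopology G]
    {μ : Measure SL(2, ℝ)} (hμ : IsCovolumeMeasure G μ)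
    (hnc : ¬ CompactSpace (MulAction.orbitRel.Quotient G ℍ)) (K : ℝ) :
    ∃ M : ℝ, 0 ≤ M ∧ K < ∫ g, min (cuspWeight G g) M ∂μ := by
  have hfin : IsFiniteMeasure μ := ⟨hμ.lt_top⟩
  obtain ⟨c, hc0, hc⟩ := exists_encard_conj_le G
  obtain ⟨V, hVo, hV1, hVdist, hVV⟩ : ∃ V : Set SL(2, ℝ), IsOpen V ∧ 1 ∈ V ∧
      (∀ v ∈ V, dist (v • UpperHalfPlane.I) UpperHalfPlane.I < 1) ∧
      ∀ v ∈ V, ∀ w ∈ V, entryNorm (((v * w⁻¹ : SL(2, ℝ)) : Matrix (Fin 2) (Fin 2) ℝ) - 1) ≤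
        1 / 36 := by
    have hU : {m : SL(2, ℝ) | entryNorm ((m : Matrix (Fin 2) (Fin 2) ℝ) - 1) < 1 / 36} ∈
        𝓝 (1 : SL(2, ℝ)) :=
      (isOpen_lt continuous_entryNorm_sub_one continuous_const).mem_nhds (by simp [entryNorm])
    obtain ⟨W, hW, hWs⟩ := exists_nhds_split_inv hU
    have hcont : Continuous fun g : SL(2, ℝ) => g • UpperHalfPlane.I := by fun_prop
    refine ⟨interior W ∩ (fun g : SL(2, ℝ) => g • UpperHalfPlane.I) ⁻¹'
      Metric.ball UpperHalfPlane.I 1, isOpen_interior.inter (Metric.isOpen_ball.preimage hcont),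
      ⟨mem_interior_iff_mem_nhds.2 hW, by simp⟩, fun v hv => hv.2, fun v hv w hw => ?_⟩
    have := hWs v (interior_subset hv.1) w (interior_subset hw.1)
    rw [div_eq_mul_inv] at this
    exact le_of_lt this
  -- The distance varies by less than `1` from `3 * k` on `E k`, so the spacing `3` keeps these sets
  -- disjoint.
  choose h hh hfrob using fun k : ℕ =>
    exists_infDist_eq_frobSq_le hnc (r := 3 * k) (by positivity)
  set B : ℕ → Set SL(2, ℝ) := fun k => {g | (h k)⁻¹ * g ∈ V}
  set E : ℕ → Set SL(2, ℝ) := fun k => {g | ∃ γ ∈ G, γ * g ∈ B k}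
  have hBo : ∀ k, IsOpen (B k) := fun k => hVo.preimage (continuous_const_mul _)
  have hEo : ∀ k, IsOpen (E k) := by
    intro k
    have : E k = ⋃ γ ∈ G, (fun g => γ * g) ⁻¹' B k := by
      ext g
      simp [E]
    rw [this]
    exact isOpen_biUnion fun γ _ => (hBo k).preimage (continuous_const_mul _)
  have hEG : ∀ k, IsLeftInvariantSet G (E k) := by
    intro k γ hγ g
    constructor
    · rintro ⟨γ', hγ', h'⟩
      exact ⟨γ' * γ, G.mul_mem hγ' hγ, by rwa [mul_assoc]⟩
    · rintro ⟨γ', hγ', h'⟩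
      exact ⟨γ' * γ⁻¹, G.mul_mem hγ' (G.inv_mem hγ), by simpa [mul_assoc] using h'⟩
  have hBE : ∀ k, B k ⊆ E k := fun k g hg => ⟨1, G.one_mem, by simpa using hg⟩
  have hdist : ∀ k, ∀ g ∈ E k,
      |Metric.infDist (g • UpperHalfPlane.I) (MulAction.orbit G UpperHalfPlane.I) - 3 * k| < 1 := by
    rintro k g ⟨γ, hγ, hg⟩
    have h1 := hVdist _ hg
    rw [← dist_smul (h k), ← mul_smul, mul_inv_cancel_left, mul_smul] at h1
    rw [← infDist_orbit_smul hγ, ← hh k]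
    have h2 := Metric.infDist_le_infDist_add_dist (s := MulAction.orbit G UpperHalfPlane.I)
      (x := γ • g • UpperHalfPlane.I) (y := h k • UpperHalfPlane.I)
    have h3 := Metric.infDist_le_infDist_add_dist (s := MulAction.orbit G UpperHalfPlane.I)
      (x := h k • UpperHalfPlane.I) (y := γ • g • UpperHalfPlane.I)
    rw [dist_comm] at h3
    rw [abs_lt]
    constructor <;> linarith
  set v := haarSL.real V
  have hVtop : haarSL V ≠ ⊤ := by
    have hcomp := UpperHalfPlane.isProperMap_smul_I.isCompact_preimage
      (isCompact_closedBall UpperHalfPlane.I 1)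
    refine (lt_of_le_of_lt (measure_mono fun w hw => ?_) hcomp.measure_lt_top).ne
    exact (hVdist w hw).le
  have hv0 : 0 < v := ENNReal.toReal_pos (hVo.measure_pos haarSL ⟨1, hV1⟩).ne' hVtop
  have hmass : ∀ k : ℕ, v ≤ (4 * c * Real.exp 1 + 3) * Real.exp (3 * k) * μ.real (E k) := by
    intro k
    -- With one solution `γ₀` fixed, every other one gives an element of `(h k)⁻¹ G (h k)` near the
    -- identity.
    have h1 : ∀ g, {γ | γ ∈ G ∧ γ * g ∈ B k}.encard ≤ (2 * ⌈c * frobSq (h k)⌉₊ + 1 : ℕ) := by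
      intro g
      rcases eq_empty_or_nonempty {γ | γ ∈ G ∧ γ * g ∈ B k} with h0 | ⟨γ₀, hγ₀, hγ₀B⟩
      · simp [h0]
      refine le_trans ?_ (hc (h k))
      refine encard_le_encard_of_injOn (f := fun γ => (h k)⁻¹ * (γ * γ₀⁻¹) * h k) ?_ ?_
      · rintro γ ⟨hγ, hγB⟩
        refine ⟨?_, ?_⟩
        · simpa [mul_assoc] using G.mul_mem hγ (G.inv_mem hγ₀)
        · have := hVV _ hγB _ hγ₀B
          rwa [show (h k)⁻¹ * (γ * g) * ((h k)⁻¹ * (γ₀ * g))⁻¹ =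
            (h k)⁻¹ * (γ * γ₀⁻¹) * h k by group] at this
      · intro γ _ γ' _ hγγ'
        simpa using hγγ'
    have h2 := hμ.haarSL_le (B k) (E k) _ (hBo k).measurableSet (hEo k).measurableSet (hEG k)
      (hBE k) h1
    have h3 : haarSL (B k) = haarSL V := measure_preimage_mul haarSL (h k)⁻¹ V
    rw [h3] at h2
    have h4 := ENNReal.toReal_mono (ENNReal.mul_ne_top (ENNReal.natCast_ne_top _)
      (measure_ne_top μ _)) h2
    rw [ENNReal.toReal_mul, ENNReal.toReal_natCast] at h4
    refine h4.trans (mul_le_mul_of_nonneg_right ?_ measureReal_nonneg)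
    have h5 : c * frobSq (h k) ≤ c * (2 * Real.exp (3 * k + 1)) :=
      mul_le_mul_of_nonneg_left (hfrob k) hc0.le
    have h6 := (Nat.ceil_lt_add_one (a := c * frobSq (h k))
      (mul_nonneg hc0.le (two_pos.le.trans (two_le_frobSq _)))).le
    have h7 : 1 ≤ Real.exp (3 * k) := Real.one_le_exp (by positivity)
    rw [Real.exp_add] at h5
    push_cast
    nlinarith
  set a := v / (4 * c * Real.exp 1 + 3) * Real.exp (-1) with ha
  have hD0 : 0 < 4 * c * Real.exp 1 + 3 := by positivity
  have ha0 : 0 < a := by positivity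
  have hterm : ∀ k : ℕ, a ≤ Real.exp (3 * k - 1) * μ.real (E k) := by
    intro k
    have h1 : v / (4 * c * Real.exp 1 + 3) ≤ Real.exp (3 * k) * μ.real (E k) := by
      rw [div_le_iff₀ hD0]
      linarith [hmass k]
    calc a ≤ Real.exp (3 * k) * μ.real (E k) * Real.exp (-1) := by rw [ha]; gcongr
      _ = Real.exp (3 * k - 1) * μ.real (E k) := by rw [sub_eq_add_neg, Real.exp_add]; ring
  -- Each `E k` contributes at least `a`, and truncation at `exp (3 * n)` does not affect the weight
  -- on those with `k < n`.
  obtain ⟨n, hn⟩ := exists_nat_gt (K / a)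
  rw [div_lt_iff₀ ha0] at hn
  refine ⟨Real.exp (3 * n), (Real.exp_pos _).le, ?_⟩
  have hpt : ∀ g, ∑ k ∈ Finset.range n, (E k).indicator (fun _ => Real.exp (3 * k - 1)) g ≤
      min (cuspWeight G g) (Real.exp (3 * n)) := by
    intro g
    by_cases hg : ∃ k ∈ Finset.range n, g ∈ E k
    · obtain ⟨k, hk, hgk⟩ := hg
      rw [Finset.sum_eq_single_of_mem k hk]
      · have hkn : (k : ℝ) ≤ n := by exact_mod_cast (Finset.mem_range.1 hk).le
        have h1 := (abs_lt.1 (hdist k g hgk)).1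
        rw [indicator_of_mem hgk]
        exact le_min (Real.exp_le_exp.2 (by linarith)) (Real.exp_le_exp.2 (by linarith))
      · intro j _ hjk
        refine indicator_of_notMem (fun hgj => hjk ?_) _
        have h1 := abs_lt.1 (hdist k g hgk)
        have h2 := abs_lt.1 (hdist j g hgj)
        have h3 : (j : ℝ) < k + 1 := by linarith
        have h4 : (k : ℝ) < j + 1 := by linarith
        norm_cast at h3 h4
        omega
    · push Not at hg
      rw [Finset.sum_eq_zero fun k hk => indicator_of_notMem (hg k hk) _]
      exact le_min (Real.exp_pos _).le (Real.exp_pos _).le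
  have hint : Integrable (fun g => min (cuspWeight G g) (Real.exp (3 * n))) μ := by
    refine Integrable.of_bound
      (continuous_cuspWeight.min continuous_const).measurable.aestronglyMeasurable
      (Real.exp (3 * n)) (ae_of_all _ fun g => ?_)
    rw [Real.norm_of_nonneg (show 0 ≤ min (cuspWeight G g) (Real.exp (3 * n)) from
      le_min (Real.exp_pos _).le (Real.exp_pos _).le)]
    exact min_le_right _ _
  calc K < n * a := hn
    _ = ∑ k ∈ Finset.range n, a := by simp
    _ ≤ ∑ k ∈ Finset.range n, Real.exp (3 * k - 1) * μ.real (E k) :=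
        Finset.sum_le_sum fun k _ => hterm k
    _ = ∫ g, ∑ k ∈ Finset.range n, (E k).indicator (fun _ => Real.exp (3 * k - 1)) g ∂μ := by
        rw [integral_finsetSum _ fun k _ =>
          (integrable_const _).indicator (hEo k).measurableSet]
        refine Finset.sum_congr rfl fun k _ => ?_
        rw [integral_indicator_const _ (hEo k).measurableSet, smul_eq_mul, mul_comm]
    _ ≤ _ := integral_mono (integrable_finsetSum _ fun k _ =>
          (integrable_const _).indicator (hEo k).measurableSet) hint hpt

end CuspWeight

/-! ### The expanding set is null -/

/-- Averaging over unit time turns integrals along the flow into Birkhoff sums of `diagFlow 1` with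
the same mean. -/
lemma IsCovolumeMeasure.integral_flow {G : Subgroup SL(2, ℝ)} {μ : Measure SL(2, ℝ)}
    (hμ : IsCovolumeMeasure G μ) {f : SL(2, ℝ) → ℝ} (hf : Measurable f)
    (hfG : ∀ γ ∈ G, ∀ g, f (γ * g) = f g) {C : ℝ} (hfC : ∀ g, |f g| ≤ C) :
    Measurable (fun g => ∫ t in (0 : ℝ)..1, f (g * diagFlow t)) ∧
      ∫ g, (∫ t in (0 : ℝ)..1, f (g * diagFlow t)) ∂μ = ∫ g, f g ∂μ := by
  have hfin : IsFiniteMeasure μ := ⟨hμ.lt_top⟩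
  have hc : Continuous diagFlow := continuous_SL fun i j => by
    fin_cases i <;> fin_cases j <;> simp <;> fun_prop
  have hm : Measurable fun p : SL(2, ℝ) × ℝ => f (p.1 * diagFlow p.2) :=
    hf.comp (measurable_fst.mul (hc.measurable.comp measurable_snd))
  simp_rw [intervalIntegral.integral_of_le zero_le_one]
  refine ⟨(hm.stronglyMeasurable.integral_prod_right
    (ν := volume.restrict (Ioc (0 : ℝ) 1))).measurable, ?_⟩
  rw [integral_integral_swap]
  · simp_rw [hμ.integral_comp_mul_right hf hfG]
    simp
  · exact Integrable.of_bound hm.aestronglyMeasurable C (ae_of_all _ fun p => hfC _)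

lemma IsCovolumeMeasure.haarSL_expandingSet_eq_zero {G : Subgroup SL(2, ℝ)} [DiscreteTopology G]
    {μ : Measure SL(2, ℝ)} (hμ : IsCovolumeMeasure G μ)
    (hnc : ¬ CompactSpace (MulAction.orbitRel.Quotient G ℍ)) {S : Set G} (hS : S.Finite)
    (hSgen : Subgroup.closure S = ⊤) {ε : ℝ} (hε : 0 < ε) : haarSL (expandingSet S ε) = 0 := by
  have hfin : IsFiniteMeasure μ := ⟨hμ.lt_top⟩
  have hcount := countable_of_discrete G
  refine (hμ.haarSL_eq_zero_or_compl (measurableSet_expandingSet S ε)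
    (isLeftInvariantSet_expandingSet hSgen ε) (fun x g => mul_mem_expandingSet_iff (by simp) ε g)
    (fun t g => mul_mem_expandingSet_iff (by simp) ε g)).resolve_right fun hcompl => ?_
  obtain ⟨C, hC0, hC⟩ : ∃ C : ℝ, 0 < C ∧
      ∀ s : G, s ∈ S ∨ s⁻¹ ∈ S → 2 * frobSq s ^ 2 * Real.exp (frobSq s ^ 2) ≤ C := by
    obtain ⟨C, hC⟩ := (hS.image fun s : G =>
      2 * frobSq (s : SL(2, ℝ)) ^ 2 * Real.exp (frobSq (s : SL(2, ℝ)) ^ 2)).bddAbove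
    refine ⟨max C 1, by positivity, fun s hs => le_max_of_le_left ?_⟩
    rcases hs with hs | hs
    · exact hC ⟨s, hs, rfl⟩
    · have := hC ⟨s⁻¹, hs, rfl⟩
      simpa only [Subgroup.coe_inv, frobSq_inv] using this
  set c := ε / C with hc
  have hc0 : 0 < c := div_pos hε hC0
  -- With this truncation `1 - c * φ` has negative integral, against the maximal ergodic theorem.
  obtain ⟨M, hM0, hM⟩ := hμ.exists_lt_integral_min_cuspWeight hnc (μ.real univ / c)
  set φ : SL(2, ℝ) → ℝ := fun g => min (cuspWeight G g) M
  have hφm : Measurable φ := (continuous_cuspWeight.min continuous_const).measurable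
  have hφ0 : ∀ g, 0 ≤ φ g := fun g => le_min (Real.exp_pos _).le hM0
  have hφM : ∀ g, φ g ≤ M := fun g => min_le_right _ _
  have hφG : ∀ γ ∈ G, ∀ g, φ (γ * g) = φ g := fun γ hγ g => by simp only [φ, cuspWeight_mul hγ]
  have hφle : ∀ γ ∈ G, ∀ g, φ g ≤ frobSq (γ * g) := fun γ hγ g =>
    (min_le_left _ _).trans (cuspWeight_le_frobSq hγ g)
  set ψ : SL(2, ℝ) → ℝ := fun g => 1 - c * φ g with hψ
  have hψm : Measurable ψ := measurable_const.sub (hφm.const_mul c)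
  have hψG : ∀ γ ∈ G, ∀ g, ψ (γ * g) = ψ g := fun γ hγ g => by simp only [ψ, hφG γ hγ g]
  have hψb : ∀ g, |ψ g| ≤ 1 + c * M := by
    intro g
    have h1 := mul_le_mul_of_nonneg_left (hφM g) hc0.le
    have h2 := mul_nonneg hc0.le (hφ0 g)
    rw [abs_le]
    constructor <;> simp only [hψ] <;> linarith
  obtain ⟨hfm, hfint⟩ := hμ.integral_flow hψm hψG hψb
  have hpos := hμ.integral_nonneg_of_birkhoffSum_pos hfm
    (fun γ hγ g => by simp only [mul_assoc, hψG γ hγ]) (C := 1 + c * M)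
    (fun g => by
      have := intervalIntegral.norm_integral_le_of_norm_le_const (a := 0) (b := 1)
        (f := fun t => ψ (g * diagFlow t)) (C := 1 + c * M) fun t _ => hψb _
      simpa using this) (diagFlow 1) ?_
  · rw [hfint, integral_sub (integrable_const _), integral_const, integral_const_mul] at hpos
    · rw [div_lt_iff₀ hc0] at hM
      simp only [smul_eq_mul, mul_one] at hpos
      linarith
    · exact (Integrable.of_bound hφm.aestronglyMeasurable M
        (ae_of_all _ fun g => by rw [Real.norm_of_nonneg (hφ0 g)]; exact hφM g)).const_mul c
  · have hac : μ ≪ haarSL := hμ.le_haarSL.absolutelyContinuous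
    have hae : ∀ᵐ g ∂μ, g ∈ expandingSet S ε := hac hcompl
    filter_upwards [hae] with g hg
    obtain ⟨n, hn⟩ := exists_intervalIntegral_pos hφm hφM hφ0 hφle hC0 hC hε hg
    refine ⟨n, ?_⟩
    rw [birkhoffSum_flow hψm hψb]
    exact hn

/-! ### Rotations and the boundary circle -/

/-- The matrix that rotates the boundary circle of the disc by the angle `θ`. -/
noncomputable def rotation (θ : ℝ) : SL(2, ℝ) :=
  ⟨!![Real.cos (θ / 2), Real.sin (θ / 2); -Real.sin (θ / 2), Real.cos (θ / 2)], by
    rw [Matrix.det_fin_two_of]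
    nlinarith [Real.sin_sq_add_cos_sq (θ / 2)]⟩

@[simp] lemma rotation_coe (θ : ℝ) : (rotation θ : Matrix (Fin 2) (Fin 2) ℝ) =
    !![Real.cos (θ / 2), Real.sin (θ / 2); -Real.sin (θ / 2), Real.cos (θ / 2)] := rfl

lemma rotation_zero : rotation 0 = 1 := by
  ext i j
  fin_cases i <;> fin_cases j <;> simp

lemma rotation_add (θ η : ℝ) : rotation (θ + η) = rotation θ * rotation η := by
  ext i j
  fin_cases i <;> fin_cases j <;>
    simp [-Matrix.SpecialLinearGroup.coe_mul, mul_entry, add_div, Real.cos_add, Real.sin_add] <;>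
    ring

lemma colSq_rotation (θ : ℝ) : colSq (rotation θ) 0 = 1 := by
  simp [colSq]

/-- Iwasawa decomposition. -/
lemma exists_rotation_mul (g : SL(2, ℝ)) : ∃ η : ℝ, ∃ b : SL(2, ℝ), b 1 0 = 0 ∧
    g = rotation η * b := by
  have hz : (⟨g 0 0, -g 1 0⟩ : ℂ) ≠ 0 := by
    intro h
    have h1 := congrArg Complex.re h
    have h2 := congrArg Complex.im h
    simp at h1 h2
    have := det_eq_one g
    simp [h1, h2] at this
  set z : ℂ := ⟨g 0 0, -g 1 0⟩
  refine ⟨2 * z.arg, rotation (-(2 * z.arg)) * g, ?_, ?_⟩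
  · have h1 := Complex.cos_arg hz
    have h2 := Complex.sin_arg z
    rw [mul_entry]
    simp only [rotation_coe, Matrix.of_apply, Matrix.cons_val', Matrix.cons_val_zero,
      Matrix.cons_val_one, Matrix.cons_val_fin_one, neg_div, Real.sin_neg, Real.cos_neg]
    rw [show 2 * z.arg / 2 = z.arg by ring, h1, h2]
    simp only [z]
    ring
  · rw [← mul_assoc, ← rotation_add, add_neg_cancel, rotation_zero, one_mul]

/-- The complex derivative is `1 / D ^ 2`, and `rotation θ` carries `∞`, which is the point `1` of
the circle, to `exp (i θ)`. -/
lemma absDeriv_boundaryMap (g : SL(2, ℝ)) (θ : ℝ) :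
    absDeriv (boundaryMap g) (Circle.exp θ) = (colSq (g * rotation θ) 0)⁻¹ := by
  set w : ℝ → ℂ := fun t => (Circle.exp θ : ℂ) * Circle.exp t with hw
  have hw0 : w 0 = Circle.exp θ := by simp [hw]
  have hwd : HasDerivAt w ((Circle.exp θ : ℂ) * Complex.I) 0 := by
    have h1 : HasDerivAt (fun t : ℝ => Complex.exp (t * Complex.I)) Complex.I 0 := by
      have h2 : HasDerivAt (fun t : ℝ => (t : ℂ) * Complex.I) Complex.I 0 := by
        simpa using (Complex.ofRealCLM.hasDerivAt (x := (0 : ℝ))).mul_const Complex.I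
      simpa using h2.cexp
    simpa [hw] using h1.const_mul (Circle.exp θ : ℂ)
  set D := conj (discB g) * (Circle.exp θ : ℂ) + conj (discA g) with hD
  have hD0 : D ≠ 0 := discMap_denom_ne_zero g (Circle.norm_coe _).le
  have hnum : HasDerivAt (fun t => discA g * w t + discB g)
      (discA g * ((Circle.exp θ : ℂ) * Complex.I)) 0 := (hwd.const_mul _).add_const _
  have hden : HasDerivAt (fun t => conj (discB g) * w t + conj (discA g))
      (conj (discB g) * ((Circle.exp θ : ℂ) * Complex.I)) 0 := (hwd.const_mul _).add_const _
  have hder := hnum.fun_div hden (by rw [hw0]; exact hD0)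
  rw [hw0, ← hD] at hder
  have hnorm : discA g * conj (discA g) - discB g * conj (discB g) = 1 := by
    rw [Complex.mul_conj, Complex.mul_conj, ← Complex.ofReal_sub, normSq_discA_sub,
      Complex.ofReal_one]
  have hval : discA g * ((Circle.exp θ : ℂ) * Complex.I) * D -
      (discA g * (Circle.exp θ : ℂ) + discB g) *
        (conj (discB g) * ((Circle.exp θ : ℂ) * Complex.I)) =
      (Circle.exp θ : ℂ) * Complex.I := by
    rw [hD]
    linear_combination ((Circle.exp θ : ℂ) * Complex.I) * hnorm
  rw [hval] at hder
  have hcoe : (fun t : ℝ => (boundaryMap g (Circle.exp θ * Circle.exp t) : ℂ)) =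
      fun t => (discA g * w t + discB g) / (conj (discB g) * w t + conj (discA g)) := by
    ext t
    simp [boundaryMap, discMap, hw]
  rw [absDeriv, hcoe, hder.deriv, norm_div, norm_mul, Circle.norm_coe, Complex.norm_I, one_mul,
    one_div, norm_pow, ← Complex.normSq_eq_norm_sq]
  congr 1
  have hexp : (Circle.exp θ : ℂ) = ⟨Real.cos θ, Real.sin θ⟩ := by
    rw [Circle.coe_exp]
    apply Complex.ext <;> simp [Complex.exp_ofReal_mul_I_re, Complex.exp_ofReal_mul_I_im]
  have hX := Real.sin_sq_add_cos_sq (θ / 2)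
  have hcos : Real.cos θ = Real.cos (θ / 2) ^ 2 - Real.sin (θ / 2) ^ 2 := by
    rw [← Real.cos_two_mul']
    ring_nf
  have hsin : Real.sin θ = 2 * Real.sin (θ / 2) * Real.cos (θ / 2) := by
    rw [← Real.sin_two_mul]
    ring_nf
  rw [hD, hexp, hcos, hsin]
  simp only [Complex.normSq_apply, Complex.add_re, Complex.add_im, Complex.mul_re, Complex.mul_im,
    Complex.conj_re, Complex.conj_im, discA, discB, colSq, mul_entry, rotation_coe, Matrix.of_apply,
    Matrix.cons_val', Matrix.cons_val_zero, Matrix.cons_val_one, Matrix.cons_val_fin_one]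
  generalize Real.cos (θ / 2) = C at *
  generalize Real.sin (θ / 2) = s at *
  linear_combination ((((g 0 0 - g 1 1) / 2) ^ 2 + ((g 0 1 + g 1 0) / 2) ^ 2) * (s ^ 2 + C ^ 2) -
    (((g 0 0 + g 1 1) / 2) ^ 2 + ((g 0 1 - g 1 0) / 2) ^ 2)) * hX

/-- Fubini gives a `g` with `rotation θ * g ∉ N` for almost all `θ`; writing `g = rotation η * b`,
the factor `b` is harmless and `η` only shifts the angle. -/
lemma ae_rotation_notMem {N : Set SL(2, ℝ)} (hN : MeasurableSet N) (h0 : haarSL N = 0)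
    (hNb : ∀ h b : SL(2, ℝ), b 1 0 = 0 → (h * b ∈ N ↔ h ∈ N)) :
    ∀ᵐ θ : ℝ, rotation θ ∉ N := by
  have hc : Continuous rotation := continuous_SL fun i j => by
    fin_cases i <;> fin_cases j <;> simp <;> fun_prop
  have hmeas : MeasurableSet {p : ℝ × SL(2, ℝ) | rotation p.1 * p.2 ∈ N} :=
    ((hc.measurable.comp measurable_fst).mul measurable_snd) hN
  have h1 : ((volume : Measure ℝ).prod haarSL) {p : ℝ × SL(2, ℝ) | rotation p.1 * p.2 ∈ N} = 0 := by
    rw [Measure.measure_prod_null hmeas]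
    exact ae_of_all _ fun θ => (measure_preimage_mul haarSL (rotation θ) N).trans h0
  rw [Measure.prod_apply_symm hmeas, lintegral_eq_zero_iff (measurable_measure_prodMk_right hmeas)]
    at h1
  obtain ⟨g, hg⟩ := h1.exists
  obtain ⟨η, b, hb, rfl⟩ := exists_rotation_mul g
  have h2 : volume ((fun θ : ℝ => θ + η) ⁻¹' {θ | rotation θ ∈ N}) = 0 := by
    refine Eq.trans (congrArg _ ?_) hg
    ext θ
    simp only [mem_preimage, mem_ofPred_eq]
    rw [rotation_add, ← hNb _ b hb, mul_assoc]
  rw [measure_preimage_add_right] at h2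
  simpa [ae_iff] using h2

lemma lyapunovExpansionExponent_eq_zero {G : Subgroup SL(2, ℝ)} {S : Set G} {θ : ℝ}
    (h : ∀ ε > 0, rotation θ ∉ expandingSet S ε) :
    lyapunovExpansionExponent (fun g : G => boundaryMap (g : SL(2, ℝ))) S (Circle.exp θ) = 0 := by
  have hlog : ∀ g : G, Real.log (absDeriv (boundaryMap (g : SL(2, ℝ))) (Circle.exp θ)) =
      Real.log (colSq (rotation θ) 0) - Real.log (colSq (g * rotation θ) 0) := by
    intro g
    rw [absDeriv_boundaryMap, Real.log_inv, colSq_rotation, Real.log_one, zero_sub]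
  simp only [lyapunovExpansionExponent, hlog]
  apply le_antisymm
  · by_contra! hlt
    obtain ⟨x, hx0, hx⟩ := EReal.lt_iff_exists_real_btwn.1 hlt
    have hx0' : 0 < x := by exact_mod_cast hx0
    -- Half of `x` is the expansion rate; the other half absorbs the surplus `J` once `R ≥ 2 * J /
    -- x`.
    have h1 := h (x / 2) (by positivity)
    simp only [expandingSet, mem_ofPred_eq] at h1
    push Not at h1
    obtain ⟨J, hJ⟩ := h1
    refine absurd hx (not_lt.2 (limsup_le_of_le (h := ?_)))
    filter_upwards [eventually_ge_atTop (⌈2 * J / x⌉₊ + 1)] with R hR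
    refine iSup₂_le fun g hg => EReal.coe_le_coe_iff.2 ?_
    have hR1 : (⌈2 * J / x⌉₊ : ℝ) + 1 ≤ R := by exact_mod_cast hR
    have hR2 : 2 * J / x ≤ R := by linarith [Nat.le_ceil (2 * J / x)]
    have hR0 : 0 < (R : ℝ) := by
      have : (0 : ℝ) ≤ (⌈2 * J / x⌉₊ : ℝ) := Nat.cast_nonneg _
      linarith
    rw [div_le_iff₀ hx0'] at hR2
    rw [one_div, inv_mul_le_iff₀ hR0]
    have := hJ R g hg
    linarith
  -- The identity lies in every ball and contributes `0`.
  · refine le_limsup_of_le (h := fun b hb => ?_)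
    obtain ⟨R, hR⟩ := hb.exists
    refine le_trans ?_ hR
    have h1 : (1 : G) ∈ wordBall S R := ⟨[], by simp, by simp, rfl⟩
    refine le_trans ?_ (le_iSup₂ (1 : G) h1)
    simp

end Fuchsian

theorem theorem1p3 (G : Subgroup SL(2, ℝ)) (hdiscrete : DiscreteTopology G)
    (hcofinite : Fuchsian.HasFiniteCoarea G)
    (hnoncocompact : ¬ CompactSpace (MulAction.orbitRel.Quotient G ℍ))
    (S : Set G) (hSfinite : S.Finite) (hSgen : Subgroup.closure S = ⊤) :
    ∀ᵐ θ : ℝ, Fuchsian.lyapunovExpansionExponent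
      (fun g : G => Fuchsian.boundaryMap (g : SL(2, ℝ))) S (Circle.exp θ) = 0 := by
  obtain ⟨F, hF, hvol⟩ := hcofinite
  have hμ := Fuchsian.isCovolumeMeasure_restrict hF hvol UpperHalfPlane.I
  have hcount := Fuchsian.countable_of_discrete G
  -- Countably many rates suffice, since `expandingSet` shrinks as the rate grows.
  have hae : ∀ᵐ θ : ℝ, ∀ m : ℕ, Fuchsian.rotation θ ∉ Fuchsian.expandingSet S (1 / (m + 1)) :=
    MeasureTheory.ae_all_iff.2 fun m => Fuchsian.ae_rotation_notMem
      (Fuchsian.measurableSet_expandingSet S _)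
      (hμ.haarSL_expandingSet_eq_zero hnoncocompact hSfinite hSgen Nat.one_div_pos_of_nat)
      fun h b hb => Fuchsian.mul_mem_expandingSet_iff hb _ h
  filter_upwards [hae] with θ hθ
  refine Fuchsian.lyapunovExpansionExponent_eq_zero fun ε hε hmem => ?_
  obtain ⟨m, hm⟩ := exists_nat_one_div_lt hε
  refine hθ m fun J => ?_
  obtain ⟨n, g, hg, hlt⟩ := hmem J
  refine ⟨n, g, hg, lt_of_le_of_lt ?_ hlt⟩
  gcongr
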